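/- **Setting.** Let $\mathcal X$ be a measurable space, $n,t\ge 0$ integers, and $\mathcal F$ a finite non-empty class of measurable node functions $\mathcal X\to\{0,1\}$. A problem instance is a dataset $D=((X_1,y_1),\dots,(X_n,y_n))$ with $X_i\in\mathcal X$ and real labels $y_i\ge 0$. For a binary tree $T$ whose internal nodes carry Boolean functions, let $y_l$ be the collection of labels of the examples mapped to the leaf $l$, $\overline{y_l}$ their mean and $w(l)=|y_l|$ their number. For $p\in[0,1)$ the $p$-Tweedie criterion is $$g_p(y_l)=\frac{2}{|y_l|}\sum_{y\in y_l}\left(\frac{\max\{y,0\}^{2-p}}{(1-p)(2-p)}-\frac{y\,\overline{y_l}^{\,1-p}}{1-p}+\frac{\overline{y_l}^{\,2-p}}{2-p}\right),$$ and $g_1(y_l)=\frac{2}{|y_l|}\sum_{y\in y_l}\left(y\log\frac{y}{\overline{y_l}}-y+\overline{y_l}\right)$ is its limit as $p\to1$ (with $0\log 0=0$, and the value for a leaf without examples is $0$). Put $G_p(T)=\sum_{l\in\mathrm{leaves}(T)}w(l)\,g_p(y_l)$. Write $T_{l\to f}$ for the tree obtained from $T$ by replacing the leaf $l$ by an internal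 node labelled $f$ with two new leaves. The top-down learner with power $p$ starts from a single leaf and performs $t$ times a split $T\mapsto T_{l^*\to f^*}$ with $(l^*,f^*)\in\mathrm{argmin}_{l\in\mathrm{leaves}(T),\,f\in\mathcal F}G_p(T_{l\to f})$, where ties are broken by an arbitrary fixed rule that selects one minimizer as a function of the current tree and of the set of minimizers. The result $T_p(D)$ predicts at each leaf the mean label of that leaf. Its loss is $L_p(D)=\frac1n\sum_{i=1}^n\ell(T_p(D)(X_i),y_i)$ (and $0$ if $n=0$), where $\ell:\mathbb R\times\mathbb R\to[0,H]$ is any measurable function and $H>0$ (for instance the 0-1 loss, with $H=1$). A power $\hat p\in[0,1]$ is learned by ERM over the sample $D_1,\dots,D_N$ if it minimizes $\sum_{j=1}^N L_p(D_j)$ over $p\in[0,1]$. It is $\epsilon$-optimal for a distribution $\mathcal D$ if $\mathbb E_{D\sim\mathcal D}L_{\hat p}(D)\le\mathbb E_{D\sim\mathcal D}L_{p}(D)+\epsilon$ for every $p\in[0,1]$. **Theorem.** There is an absolute constant $C>0$ such that the following hold. 1. *(Sample complexity.)* Let $\mathcal X,n,t,\mathcal F,\ell,H$ and the tie-breaking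 rule be as above, and let $\mathcal D$ be a probability distribution over instances with $n$ examples whose labels are almost surely non-negative. Then $L_p$ is $\mathcal D$-integrable for every $p\in[0,1]$ and an ERM power exists for every sample. Moreover, for all $\epsilon,\delta>0$ and all integers $$N\ \ge\ C\,\frac{H^2}{\epsilon^2}\left(t\left(\log|\mathcal F|+n\right)+\log\frac1\delta\right),$$ with probability at least $1-\delta$ over the i.i.d. draw of $D_1,\dots,D_N\sim\mathcal D$, every power $\hat p\in[0,1]$ learned by ERM over the sample is $\epsilon$-optimal (the set of samples for which this fails has outer measure at most $\delta$). 2. *(Split comparisons.)* Let $D$ be a dataset of $n$ examples with non-negative labels, $T$ a tree, $l_1,l_2$ leaves of $T$ and $f_1,f_2$ Boolean functions on $\mathcal X$. Then $(1-p)(2-p)\bigl(G_p(T_{l_1\to f_1})-G_p(T_{l_2\to f_2})\bigr)$ is, on $[0,1)$, an exponential sum $\sum_{j=1}^m c_je^{b_jp}$ with real $c_j,b_j$ and $m\le Cn$ terms. The equation $G_p(T_{l_1\to f_1})=G_p(T_{l_2\to f_2})$ either holds for all $p\in[0,1]$ or has at most $Cn$ roots $p\in[0,1]$. -/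

import Mathlib

open MeasureTheory

/-- Binary decision trees over the input domain `X`: internal nodes carry a Boolean node function,
leaves carry no data (their predictions are computed from the dataset, see `RegTree.predict`). -/
inductive RegTree (X : Type*) where
  | leaf : RegTree X
  | node (f : X → Bool) (left right : RegTree X) : RegTree X

/-- A regression problem instance with `n` labelled examples `(Xᵢ, yᵢ)`. -/
abbrev RegDataset (X : Type*) (n : ℕ) : Type _ := Fin n → X × ℝ

namespace RegTree

variable {X : Type*}

/-- The leaves of a tree, each one given by its address: the path from the root
(`false` = left, `true` = right). -/
def leaves : RegTree X → Finset (List Bool)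
  | leaf => {[]}
  | node _ l r => l.leaves.image (List.cons false) ∪ r.leaves.image (List.cons true)

/-- The address of the leaf to which the input `x` is routed. -/
def route : RegTree X → X → List Bool
  | leaf, _ => []
  | node f l r, x => if f x = true then true :: r.route x else false :: l.route x

/-- `T.split a f` is the tree in which the leaf at address `a` is replaced by an internal node
labelled `f` with two new leaves as children (and `T` itself if `a` is no leaf of `T`). -/
def split : RegTree X → List Bool → (X → Bool) → RegTree X
  | leaf, [], f => node f leaf leaf
  | node g l r, false :: a, f => node g (l.split a f) r
  | node g l r, true :: a, f => node g l (r.split a f)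
  | leaf, _ :: _, _ => leaf
  | node g l r, [], _ => node g l r

/-- The (indices of the) examples of `D` that are mapped to the leaf at address `a`. -/
def atLeaf {n : ℕ} (T : RegTree X) (D : RegDataset X n) (a : List Bool) : Finset (Fin n) :=
  Finset.univ.filter fun i => T.route (D i).1 = a

end RegTree

noncomputable section

/-- The mean of the labels `y i`, `i ∈ S`. -/
def labelMean {n : ℕ} (y : Fin n → ℝ) (S : Finset (Fin n)) : ℝ :=
  (∑ i ∈ S, y i) / (S.card : ℝ)

/-- The mean Tweedie deviance with power `p ∈ [0, 1]` of the labels `y i`, `i ∈ S`, around their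
mean. For `p = 1` the value is the limit as `p → 1`, twice the half Poisson deviance
(`0 * log 0 = 0`). -/
def tweedieDeviance {n : ℕ} (p : ℝ) (y : Fin n → ℝ) (S : Finset (Fin n)) : ℝ :=
  if p = 1 then
    2 / (S.card : ℝ) *
      ∑ i ∈ S, (y i * Real.log (y i / labelMean y S) - y i + labelMean y S)
  else
    2 / (S.card : ℝ) *
      ∑ i ∈ S, ((max (y i) 0) ^ (2 - p) / ((1 - p) * (2 - p))
        - y i * (labelMean y S) ^ (1 - p) / (1 - p)
        + (labelMean y S) ^ (2 - p) / (2 - p))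

namespace RegTree

variable {X : Type*} {n : ℕ}

/-- The splitting function `G_p(T) = ∑ w(l) g_p(y_l)`, summed over the leaves `l` of `T`, where
`w(l)` is the number of examples in `l` and `g_p` the `p`-Tweedie criterion. -/
def splitObjective (p : ℝ) (T : RegTree X) (D : RegDataset X n) : ℝ :=
  ∑ a ∈ T.leaves, ((T.atLeaf D a).card : ℝ) * tweedieDeviance p (fun i => (D i).2) (T.atLeaf D a)

/-- The candidate splits: a leaf of `T` and a node function from `F`. -/
def candidates (F : Finset (X → Bool)) (T : RegTree X) : Finset (List Bool × (X → Bool)) :=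
  T.leaves ×ˢ F

open Classical in
/-- The set of all minimizers of `G_p(T_{l → f})` over the leaves `l` of `T` and `f ∈ F`. -/
def bestSplits (F : Finset (X → Bool)) (p : ℝ) (D : RegDataset X n) (T : RegTree X) :
    Finset (List Bool × (X → Bool)) :=
  (T.candidates F).filter fun c => ∀ d ∈ T.candidates F,
    splitObjective p (T.split c.1 c.2) D ≤ splitObjective p (T.split d.1 d.2) D

/-- Top-down learning with the `p`-Tweedie criterion: start from a single leaf and split `t` times,
each time by a minimizer of the splitting function. `tie` is the rule that selects one
minimizer from the set of all of them. -/
def topDown (F : Finset (X → Bool))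
    (tie : RegTree X → Finset (List Bool × (X → Bool)) → List Bool × (X → Bool))
    (p : ℝ) (D : RegDataset X n) : ℕ → RegTree X
  | 0 => leaf
  | t + 1 =>
    let T := topDown F tie p D t
    let c := tie T (T.bestSplits F p D)
    T.split c.1 c.2

/-- The prediction at `x` of the tree `T` fitted to `D`: the mean label of the examples in the leaf
to which `x` is routed. -/
def predict (T : RegTree X) (D : RegDataset X n) (x : X) : ℝ :=
  labelMean (fun i => (D i).2) (T.atLeaf D (T.route x))

/-- The average over the examples of `D` of the loss `ℓ` (prediction, label). -/
def loss (ℓ : ℝ → ℝ → ℝ) (T : RegTree X) (D : RegDataset X n) : ℝ :=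
  (1 / (n : ℝ)) * ∑ i, ℓ (T.predict D (D i).1) (D i).2

end RegTree

/-- The loss, on the instance `D`, of the tree of size `t` that is learned from `D` with
the Tweedie power `p`. -/
def tweedieLoss {X : Type*} {n : ℕ} (F : Finset (X → Bool))
    (tie : RegTree X → Finset (List Bool × (X → Bool)) → List Bool × (X → Bool))
    (t : ℕ) (ℓ : ℝ → ℝ → ℝ) (p : ℝ) (D : RegDataset X n) : ℝ :=
  (RegTree.topDown F tie p D t).loss ℓ D

/-- `p` is an empirical risk minimizer over the parameter space `[0, 1]` for the loss `L` and the
sample `S` of problem instances. -/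
def IsERM {Ω : Type*} {N : ℕ} (L : ℝ → Ω → ℝ) (S : Fin N → Ω) (p : ℝ) : Prop :=
  p ∈ Set.Icc (0 : ℝ) 1 ∧ ∀ q ∈ Set.Icc (0 : ℝ) 1, ∑ j, L p (S j) ≤ ∑ j, L q (S j)

/-- The expected loss of `p` exceeds that of no parameter in `[0, 1]` by more than `ε`. -/
def IsEpsOptimal {Ω : Type*} [MeasurableSpace Ω] (L : ℝ → Ω → ℝ) (μ : Measure Ω) (ε p : ℝ) :
    Prop :=
  ∀ q ∈ Set.Icc (0 : ℝ) 1, ∫ D, L p D ∂μ ≤ (∫ D, L q D ∂μ) + ε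

end

/-! Multiplied by `(1 - p) * (2 - p)`, the weighted deviance of a leaf becomes `2 ∑ y ^ (2 - p)`
minus twice the number of labels times `mean ^ (2 - p)`. When a leaf is split, the label sums of the
children add up to that of the parent, so the gain of a split only involves three means and the
comparison of two splits only six. As a function of `p < 1` it is therefore an exponential sum with
six terms, which by Rolle's theorem (`expSum_eq_zero_of_card_le`) is identically zero or has at most
six zeros. At `p = 1` the comparison is minus the derivative of this sum, so it vanishes there if
the sum does; otherwise `1` is added as a seventh exceptional point.

Every decision of the learner on a fixed dataset is determined by the comparisons of pairs of
disjoint pairs of example sets. There are at most `16 ^ n` of these, whatever the tree, the round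
and the node functions. Hence the learned tree is a step function of `p` with at most `16 ^ n * 14`
changes (`isStepFunction_topDown`).

The statistical part concerns any bounded one-parameter family of step functions with at most `K`
changes. On a sample of size `N` such a family is ordered by a rank in `{0, …, K * N}`, and squared
distances of loss vectors are at most proportional to rank differences. Dyadic chaining along the
rank (`card_exists_lt_abs_signedSum_le`) gives a tail `K * exp (-c * N * ε ^ 2 / H ^ 2)` without a
factor depending on `N`. Symmetrization by a ghost sample transfers it to uniform deviations from
the mean (`measure_exists_lt_deviation_le`). With `log K` of order `n`, a sample of order `(H / ε) ^
2 * (n + log (1 / δ))` suffices, and `n ≤ t * (log |F| + n)` for `t ≥ 1`.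

Symmetrization needs measurability of an event that is a union over uncountably many `p`;
compactness of parameter intervals reduces it to a countable dense set
(`IsSigmaSublevel.measurableSet_exists`). -/

/-! ### Zeros of real exponential sums -/

/-- Between consecutive zeros of a differentiable function there is a zero of its derivative. -/
theorem exists_finset_zeros_of_hasDerivAt {f f' : ℝ → ℝ} (hf : ∀ x, HasDerivAt f (f' x) x)
    (Z : Finset ℝ) (hZ : ∀ z ∈ Z, f z = 0) :
    ∃ W : Finset ℝ, Z.card ≤ W.card + 1 ∧ (∀ w ∈ W, f' w = 0) ∧ ∀ w ∈ W, ∃ z ∈ Z, w < z := by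
  induction Z using Finset.induction_on_max with
  | empty => exact ⟨∅, by simp⟩
  | insert a s hs ih =>
    obtain ⟨W, hW, hW0, hlt⟩ := ih fun z hz => hZ z (Finset.mem_insert_of_mem hz)
    rcases s.eq_empty_or_nonempty with rfl | hne
    · exact ⟨∅, by simp⟩
    · obtain ⟨c, hc, hc0⟩ := exists_hasDerivAt_eq_zero (hs _ (s.max'_mem hne))
        (fun x _ => (hf x).continuousAt.continuousWithinAt)
        (by rw [hZ _ (Finset.mem_insert_of_mem (s.max'_mem hne)), hZ a (Finset.mem_insert_self _ _)])
        (fun x _ => hf x)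
      -- The clause that every point of `W` lies below a point of `s` is carried along for this: the
      -- new Rolle point lies above all of `s`.
      have hcW : c ∉ W := fun h => by
        obtain ⟨z, hz, hcz⟩ := hlt c h
        exact absurd (s.le_max' z hz) (not_le.mpr (hc.1.trans hcz))
      refine ⟨insert c W, ?_, ?_, ?_⟩
      · rw [Finset.card_insert_of_notMem hcW,
          Finset.card_insert_of_notMem fun h => lt_irrefl a (hs a h)]
        omega
      · intro w hw
        rcases Finset.mem_insert.mp hw with rfl | hw
        exacts [hc0, hW0 w hw]
      · intro w hw
        rcases Finset.mem_insert.mp hw with rfl | hw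
        · exact ⟨a, Finset.mem_insert_self _ _, hc.2⟩
        · obtain ⟨z, hz, hwz⟩ := hlt w hw
          exact ⟨z, Finset.mem_insert_of_mem hz, hwz⟩

theorem hasDerivAt_expSum {m : ℕ} (c b : Fin m → ℝ) (p : ℝ) :
    HasDerivAt (fun x => ∑ j, c j * Real.exp (b j * x)) (∑ j, c j * b j * Real.exp (b j * p)) p := by
  refine HasDerivAt.fun_sum fun j _ => ?_
  exact ((((hasDerivAt_id p).const_mul (b j)).exp).const_mul (c j)).congr_deriv (by simp; ring)

/-- A real exponential sum with `m` terms and at least `m` zeros vanishes identically. -/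
theorem expSum_eq_zero_of_card_le {m : ℕ} (c b : Fin m → ℝ) (Z : Finset ℝ) (hm : m ≤ Z.card)
    (hZ : ∀ z ∈ Z, ∑ j, c j * Real.exp (b j * z) = 0) (p : ℝ) :
    ∑ j, c j * Real.exp (b j * p) = 0 := by
  induction m generalizing Z p with
  | zero => simp
  | succ m ih =>
    -- Dividing by `exp (β * x)` keeps the zeros and makes the last term constant, so the derivative
    -- has only `m` terms, and Rolle's theorem gives it at least `m` zeros.
    set β := b (Fin.last m)
    have key : ∀ x, ∑ j, c j * Real.exp ((b j - β) * x)
        = Real.exp (-β * x) * ∑ j, c j * Real.exp (b j * x) := fun x => by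
      rw [Finset.mul_sum]
      refine Finset.sum_congr rfl fun j _ => ?_
      rw [mul_left_comm, ← Real.exp_add]
      ring_nf
    have hd := hasDerivAt_expSum c fun j => b j - β
    have hd' : ∀ x, ∑ j, c j * (b j - β) * Real.exp ((b j - β) * x)
        = ∑ j : Fin m, (c j.castSucc * (b j.castSucc - β)) *
            Real.exp ((b j.castSucc - β) * x) := fun x => by
      rw [Fin.sum_univ_castSucc]
      simp [β]
    obtain ⟨W, hW, hW0, -⟩ := exists_finset_zeros_of_hasDerivAt hd Z fun z hz => by
      rw [key, hZ z hz, mul_zero]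
    have hzero := ih _ _ W (by omega) fun w hw => (hd' w).symm.trans (hW0 w hw)
    have hconst := is_const_of_deriv_eq_zero (fun x => (hd x).differentiableAt)
      fun x => (hd x).deriv.trans ((hd' x).trans (hzero x))
    obtain ⟨z, hz⟩ : Z.Nonempty := Finset.card_pos.mp (by omega)
    have := hconst p z
    rw [key, key, hZ z hz, mul_zero] at this
    exact (mul_eq_zero.mp this).resolve_left (Real.exp_pos _).ne'

/-- The zeros of a real exponential sum with `m` terms that is not identically zero form a finite
set of at most `m` elements. -/
theorem expSum_zeros_finite {m : ℕ} (c b : Fin m → ℝ)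
    (h : ¬ ∀ p, ∑ j, c j * Real.exp (b j * p) = 0) :
    ∃ Z : Finset ℝ, Z.card ≤ m ∧ ∀ p, ∑ j, c j * Real.exp (b j * p) = 0 ↔ p ∈ Z := by
  have hcard : ∀ Z : Finset ℝ, ↑Z ⊆ {p | ∑ j, c j * Real.exp (b j * p) = 0} → Z.card ≤ m :=
    fun Z hZ => by
      by_contra! hlt
      exact h (expSum_eq_zero_of_card_le c b Z hlt.le hZ)
  have hfin : {p | ∑ j, c j * Real.exp (b j * p) = 0}.Finite := by
    by_contra hinf
    obtain ⟨Z, hZ, hZm⟩ := Set.Infinite.exists_subset_card_eq hinf (m + 1)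
    have := hcard Z hZ
    omega
  exact ⟨hfin.toFinset, hcard _ (by simp), by simp⟩

/-! ### Leaves and routing under a split -/

namespace RegTree

variable {X : Type*} {n : ℕ}

/-- A leaf address is never extended by another one; this makes the two addresses created by a split
new. -/
theorem append_notMem_leaves (T : RegTree X) (a : List Bool) (ha : a ∈ T.leaves) (c : Bool) :
    a ++ [c] ∉ T.leaves := by
  induction T generalizing a with
  | leaf => simp_all [leaves]
  | node f l r ihl ihr =>
    simp only [leaves, Finset.mem_union, Finset.mem_image] at ha
    rcases ha with ⟨a, ha, rfl⟩ | ⟨a, ha, rfl⟩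
    · simpa [leaves] using ihl a ha
    · simpa [leaves] using ihr a ha

theorem route_mem_leaves (T : RegTree X) (x : X) : T.route x ∈ T.leaves := by
  induction T with
  | leaf => simp [leaves, route]
  | node f l r ihl ihr =>
    simp only [leaves, route]
    split_ifs <;> simp [ihl, ihr]

theorem leaves_nonempty (T : RegTree X) : T.leaves.Nonempty := by
  induction T with
  | leaf => simp [leaves]
  | node f l r ihl ihr => simp [leaves, ihl]

theorem mem_leaves_split (T : RegTree X) (a : List Bool) (ha : a ∈ T.leaves) (f : X → Bool)
    (b : List Bool) :
    b ∈ (T.split a f).leaves ↔ (b ∈ T.leaves ∧ b ≠ a) ∨ b = a ++ [false] ∨ b = a ++ [true] := by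
  induction T generalizing a b with
  | leaf =>
    obtain rfl : a = [] := by simpa [leaves] using ha
    simp [split, leaves]
  | node g l r ihl ihr =>
    simp only [leaves, Finset.mem_union, Finset.mem_image] at ha
    rcases ha with ⟨a, ha, rfl⟩ | ⟨a, ha, rfl⟩
    · rcases b with _ | ⟨_ | _, b⟩
      · simp [split, leaves]
      · simpa [split, leaves] using ihl a ha b
      · simp [split, leaves]
    · rcases b with _ | ⟨_ | _, b⟩
      · simp [split, leaves]
      · simp [split, leaves]
      · simpa [split, leaves] using ihr a ha b

theorem route_split (T : RegTree X) (a : List Bool) (ha : a ∈ T.leaves) (f : X → Bool) (x : X) :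
    (T.split a f).route x = if T.route x = a then a ++ [f x] else T.route x := by
  induction T generalizing a with
  | leaf =>
    obtain rfl : a = [] := by simpa [leaves] using ha
    cases h : f x <;> simp [split, route, h]
  | node g l r ihl ihr =>
    simp only [leaves, Finset.mem_union, Finset.mem_image] at ha
    rcases ha with ⟨a, ha, rfl⟩ | ⟨a, ha, rfl⟩
    · cases h : g x
      · simp only [split, route, h, ihl a ha]
        by_cases h' : l.route x = a <;> simp [h']
      · simp [split, route, h]
    · cases h : g x
      · simp [split, route, h]
      · simp only [split, route, h, ihr a ha]
        by_cases h' : r.route x = a <;> simp [h']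

end RegTree

/-! ### Gain of a split -/

section LeafCost

variable {n : ℕ}

/-- The total deviance of the labels `y i`, `i ∈ S`: the weighted contribution of a leaf to the
splitting function. -/
noncomputable def leafCost (p : ℝ) (y : Fin n → ℝ) (S : Finset (Fin n)) : ℝ :=
  (S.card : ℝ) * tweedieDeviance p y S

/-- The change of the splitting function when a leaf with examples `A ∪ B` is split into leaves with
examples `A` and `B`. -/
noncomputable def splitGain (p : ℝ) (y : Fin n → ℝ) (A B : Finset (Fin n)) : ℝ :=
  leafCost p y A + leafCost p y B - leafCost p y (A ∪ B)

end LeafCost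

namespace RegTree

variable {X : Type*} {n : ℕ}

/-- The examples at the leaf `a` of `T` on which `f` takes the value `v`. -/
def atChild (T : RegTree X) (D : RegDataset X n) (a : List Bool) (f : X → Bool) (v : Bool) :
    Finset (Fin n) :=
  (T.atLeaf D a).filter fun i => f (D i).1 = v

theorem disjoint_atChild (T : RegTree X) (D : RegDataset X n) (a : List Bool) (f : X → Bool) :
    Disjoint (T.atChild D a f false) (T.atChild D a f true) := by
  rw [Finset.disjoint_left]
  intro i hi hi'
  simp_all [atChild]

theorem atChild_union (T : RegTree X) (D : RegDataset X n) (a : List Bool) (f : X → Bool) :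
    T.atChild D a f false ∪ T.atChild D a f true = T.atLeaf D a := by
  ext i
  cases h : f (D i).1 <;> simp [atChild, h]

/-- All leaves other than `a` keep their examples, so the change depends only on the two sets of
examples sent to the children. -/
theorem splitObjective_split (p : ℝ) (T : RegTree X) (D : RegDataset X n) (a : List Bool)
    (ha : a ∈ T.leaves) (f : X → Bool) :
    (T.split a f).splitObjective p D = T.splitObjective p D
      + splitGain p (fun i => (D i).2) (T.atChild D a f false) (T.atChild D a f true) := by
  have hl : (T.split a f).leaves
      = insert (a ++ [false]) (insert (a ++ [true]) (T.leaves.erase a)) := by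
    ext b
    rw [mem_leaves_split T a ha]
    simp only [Finset.mem_insert, Finset.mem_erase]
    tauto
  have hchild : ∀ v, (T.split a f).atLeaf D (a ++ [v]) = T.atChild D a f v := fun v => by
    ext i
    simp only [atLeaf, atChild, Finset.mem_filter, Finset.mem_univ, true_and, route_split T a ha]
    by_cases h : T.route (D i).1 = a
    · simp [h]
    · simp only [h, if_false, false_and, iff_false]
      exact fun h' => append_notMem_leaves T a ha v (h' ▸ route_mem_leaves T _)
  have hother : ∀ b ∈ T.leaves.erase a, (T.split a f).atLeaf D b = T.atLeaf D b := fun b hb => by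
    ext i
    simp only [atLeaf, Finset.mem_filter, Finset.mem_univ, true_and, route_split T a ha]
    by_cases h : T.route (D i).1 = a
    · simp only [h, if_true]
      refine iff_of_false (fun h' => ?_) fun h' => (Finset.mem_erase.mp hb).1 h'.symm
      exact append_notMem_leaves T a ha _ (h' ▸ (Finset.mem_erase.mp hb).2)
    · simp [h]
  rw [splitObjective, hl, Finset.sum_insert, Finset.sum_insert, hchild, hchild,
    Finset.sum_congr rfl fun b hb => by rw [hother b hb], splitObjective,
    ← Finset.add_sum_erase _ _ ha, splitGain, atChild_union]
  · simp only [leafCost]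
    ring
  · simp [append_notMem_leaves T a ha]
  · simp [append_notMem_leaves T a ha]

end RegTree

/-! ### Comparison of two gains as a six-term exponential sum -/

section Tweedie

variable {n : ℕ}

theorem labelMean_nonneg {y : Fin n → ℝ} (hy : ∀ i, 0 ≤ y i) (S : Finset (Fin n)) :
    0 ≤ labelMean y S :=
  div_nonneg (Finset.sum_nonneg fun i _ => hy i) (Nat.cast_nonneg _)

theorem card_mul_labelMean (y : Fin n → ℝ) (S : Finset (Fin n)) :
    (S.card : ℝ) * labelMean y S = ∑ i ∈ S, y i := by
  rcases S.eq_empty_or_nonempty with rfl | h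
  · simp
  · have : (S.card : ℝ) ≠ 0 := by exact_mod_cast h.card_pos.ne'
    rw [labelMean]
    field_simp

/-- The leaf weight cancels the normalization; for an empty leaf both sides are `0`. -/
theorem card_mul_two_div (S : Finset (Fin n)) (g : Fin n → ℝ) :
    (S.card : ℝ) * (2 / (S.card : ℝ) * ∑ i ∈ S, g i) = 2 * ∑ i ∈ S, g i := by
  rcases S.eq_empty_or_nonempty with rfl | h
  · simp
  · have : (S.card : ℝ) ≠ 0 := by exact_mod_cast h.card_pos.ne'
    field_simp

/-- The labels sum to `S.card` times their mean, so the second and third terms of the deviance are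
both multiples of `mean ^ (2 - p)` and combine through `1 / (2 - p) - 1 / (1 - p) = -1 / ((1 - p) *
(2 - p))`. -/
theorem leafCost_of_lt_one {p : ℝ} (hp : p < 1) {y : Fin n → ℝ} (hy : ∀ i, 0 ≤ y i)
    (S : Finset (Fin n)) :
    (1 - p) * (2 - p) * leafCost p y S
      = 2 * ∑ i ∈ S, y i ^ (2 - p) - 2 * (S.card * labelMean y S ^ (2 - p)) := by
  have h1 : 1 - p ≠ 0 := by linarith
  have h2 : 2 - p ≠ 0 := by linarith
  have hm := labelMean_nonneg hy S
  have hpow : labelMean y S * labelMean y S ^ (1 - p) = labelMean y S ^ (2 - p) := by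
    rw [show 2 - p = 1 + (1 - p) by ring, Real.rpow_add' hm (by linarith), Real.rpow_one]
  rw [leafCost, tweedieDeviance, if_neg hp.ne, card_mul_two_div]
  have hterm : ∀ i ∈ S, max (y i) 0 ^ (2 - p) / ((1 - p) * (2 - p))
        - y i * labelMean y S ^ (1 - p) / (1 - p) + labelMean y S ^ (2 - p) / (2 - p)
      = y i ^ (2 - p) / ((1 - p) * (2 - p)) - y i * (labelMean y S ^ (1 - p) / (1 - p))
        + labelMean y S ^ (2 - p) / (2 - p) := fun i _ => by
    rw [max_eq_left (hy i)]
    ring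
  rw [Finset.sum_congr rfl hterm, Finset.sum_add_distrib, Finset.sum_sub_distrib, ← Finset.sum_div,
    ← Finset.sum_mul, ← card_mul_labelMean y S, Finset.sum_const, nsmul_eq_mul, ← hpow]
  field_simp
  ring

theorem leafCost_one {y : Fin n → ℝ} (hy : ∀ i, 0 ≤ y i) (S : Finset (Fin n)) :
    leafCost 1 y S
      = 2 * ∑ i ∈ S, y i * Real.log (y i)
        - 2 * (S.card * (labelMean y S * Real.log (labelMean y S))) := by
  rw [leafCost, tweedieDeviance, if_pos rfl, card_mul_two_div]
  have hterm : ∀ i ∈ S, y i * Real.log (y i / labelMean y S) - y i + labelMean y S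
      = y i * Real.log (y i) - y i * Real.log (labelMean y S) - y i + labelMean y S :=
    fun i hi => by
      rcases (hy i).eq_or_lt with h | h
      · simp [← h]
      -- A positive label forces a positive mean, so the logarithm of the quotient splits.
      · have hm : labelMean y S ≠ 0 := fun h0 => by
          have := card_mul_labelMean y S
          rw [h0, mul_zero] at this
          exact h.ne' ((Finset.sum_eq_zero_iff_of_nonneg fun i _ => hy i).mp this.symm i hi)
        rw [Real.log_div h.ne' hm]
        ring
  rw [Finset.sum_congr rfl hterm, Finset.sum_add_distrib, Finset.sum_sub_distrib,
    Finset.sum_sub_distrib, ← Finset.sum_mul, ← card_mul_labelMean y S, Finset.sum_const, nsmul_eq_mul]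
  ring

/-- For `m = 0` both sides vanish, so leaves of mean zero need no special case in the exponential
sum: their coefficient is `0`. -/
theorem rpow_two_sub_eq {m p : ℝ} (hm : 0 ≤ m) (hp : p ≤ 1) :
    m ^ (2 - p) = m ^ 2 * Real.exp (-Real.log m * p) := by
  rcases hm.eq_or_lt with rfl | hm
  · rw [Real.zero_rpow (by linarith)]
    simp
  · rw [Real.rpow_sub hm, Real.rpow_two, Real.rpow_def_of_pos hm, div_eq_mul_inv, ← Real.exp_neg]
    ring_nf

/-- The six leaves that are compared: `A₁`, `B₁`, their parent, `A₂`, `B₂`, their parent. -/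
def gainBlock (A₁ B₁ A₂ B₂ : Finset (Fin n)) : Fin 6 → Finset (Fin n) :=
  ![A₁, B₁, A₁ ∪ B₁, A₂, B₂, A₂ ∪ B₂]

/-- The coefficients of the exponential sum that compares two splits. -/
noncomputable def gainCoeff (y : Fin n → ℝ) (A₁ B₁ A₂ B₂ : Finset (Fin n)) (j : Fin 6) : ℝ :=
  (![-2, -2, 2, 2, 2, -2] : Fin 6 → ℝ) j * ((gainBlock A₁ B₁ A₂ B₂ j).card
    * labelMean y (gainBlock A₁ B₁ A₂ B₂ j) ^ 2)

/-- The exponents of the exponential sum that compares two splits. -/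
noncomputable def gainExponent (y : Fin n → ℝ) (A₁ B₁ A₂ B₂ : Finset (Fin n)) (j : Fin 6) : ℝ :=
  -Real.log (labelMean y (gainBlock A₁ B₁ A₂ B₂ j))

variable {y : Fin n → ℝ} {A₁ B₁ A₂ B₂ : Finset (Fin n)}

/-- By disjointness the sums of `y ^ (2 - p)` over the children cancel against the one over the
parent, leaving one term for each of the six means. -/
theorem splitGain_sub_of_lt_one {p : ℝ} (hp : p < 1) (hy : ∀ i, 0 ≤ y i) (h₁ : Disjoint A₁ B₁)
    (h₂ : Disjoint A₂ B₂) :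
    (1 - p) * (2 - p) * (splitGain p y A₁ B₁ - splitGain p y A₂ B₂)
      = ∑ j, gainCoeff y A₁ B₁ A₂ B₂ j * Real.exp (gainExponent y A₁ B₁ A₂ B₂ j * p) := by
  have hL := fun S => leafCost_of_lt_one hp hy S
  have hterm : ∀ j, gainCoeff y A₁ B₁ A₂ B₂ j * Real.exp (gainExponent y A₁ B₁ A₂ B₂ j * p)
      = (![-2, -2, 2, 2, 2, -2] : Fin 6 → ℝ) j * ((gainBlock A₁ B₁ A₂ B₂ j).card
        * labelMean y (gainBlock A₁ B₁ A₂ B₂ j) ^ (2 - p)) := fun j => by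
    rw [rpow_two_sub_eq (labelMean_nonneg hy _) hp.le, gainCoeff, gainExponent]
    ring
  rw [Finset.sum_congr rfl fun j _ => hterm j]
  have hU₁ := hL (A₁ ∪ B₁)
  have hU₂ := hL (A₂ ∪ B₂)
  rw [Finset.sum_union h₁] at hU₁
  rw [Finset.sum_union h₂] at hU₂
  simp only [splitGain, Fin.sum_univ_six, gainBlock]
  simp
  linear_combination hL A₁ + hL B₁ - hU₁ - hL A₂ - hL B₂ + hU₂

/-- The right-hand side is minus the derivative of the exponential sum at `1`, as l'Hôpital's rule
suggests for its quotient by `(1 - p) * (2 - p)`. This form lets vanishing of the sum pass to `p =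
1`. -/
theorem splitGain_sub_one (hy : ∀ i, 0 ≤ y i) (h₁ : Disjoint A₁ B₁) (h₂ : Disjoint A₂ B₂) :
    splitGain 1 y A₁ B₁ - splitGain 1 y A₂ B₂
      = -∑ j, gainCoeff y A₁ B₁ A₂ B₂ j * gainExponent y A₁ B₁ A₂ B₂ j
          * Real.exp (gainExponent y A₁ B₁ A₂ B₂ j * 1) := by
  have hterm : ∀ j, gainCoeff y A₁ B₁ A₂ B₂ j * gainExponent y A₁ B₁ A₂ B₂ j
          * Real.exp (gainExponent y A₁ B₁ A₂ B₂ j * 1)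
      = (![2, 2, -2, -2, -2, 2] : Fin 6 → ℝ) j * ((gainBlock A₁ B₁ A₂ B₂ j).card
        * (labelMean y (gainBlock A₁ B₁ A₂ B₂ j)
          * Real.log (labelMean y (gainBlock A₁ B₁ A₂ B₂ j)))) := fun j => by
    have h := rpow_two_sub_eq (labelMean_nonneg hy (gainBlock A₁ B₁ A₂ B₂ j)) le_rfl
    norm_num at h
    rw [gainCoeff, gainExponent, mul_one]
    have : (![2, 2, -2, -2, -2, 2] : Fin 6 → ℝ) j = -(![-2, -2, 2, 2, 2, -2] : Fin 6 → ℝ) j := by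
      fin_cases j <;> simp
    rw [this]
    linear_combination (![-2, -2, 2, 2, 2, -2] : Fin 6 → ℝ) j
      * (gainBlock A₁ B₁ A₂ B₂ j).card * Real.log (labelMean y (gainBlock A₁ B₁ A₂ B₂ j)) * h
  rw [Finset.sum_congr rfl fun j _ => hterm j]
  simp only [splitGain, leafCost_one hy, Finset.sum_union h₁, Finset.sum_union h₂,
    Fin.sum_univ_six, gainBlock]
  simp
  ring

/-- Either two splits are equally good for all powers, or the powers for which they are equally good,
together with `1`, lie in a finite set of at most seven points, outside of which the
comparison is governed by a continuous function. -/
theorem splitGain_sub_dichotomy (hy : ∀ i, 0 ≤ y i) (h₁ : Disjoint A₁ B₁)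
    (h₂ : Disjoint A₂ B₂) :
    (∀ p ∈ Set.Icc (0 : ℝ) 1, splitGain p y A₁ B₁ = splitGain p y A₂ B₂) ∨
      ∃ (E : ℝ → ℝ) (Z : Finset ℝ), Continuous E ∧ Z.card ≤ 7 ∧ 1 ∈ Z ∧ (∀ p, E p = 0 → p ∈ Z) ∧
        ∀ p < 1, (1 - p) * (2 - p) * (splitGain p y A₁ B₁ - splitGain p y A₂ B₂) = E p := by
  by_cases h : ∀ p, ∑ j, gainCoeff y A₁ B₁ A₂ B₂ j
      * Real.exp (gainExponent y A₁ B₁ A₂ B₂ j * p) = 0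
  · left
    intro p hp
    rcases hp.2.eq_or_lt with rfl | hp1
    · have hd := hasDerivAt_expSum (gainCoeff y A₁ B₁ A₂ B₂) (gainExponent y A₁ B₁ A₂ B₂) 1
      rw [funext h] at hd
      rw [← sub_eq_zero, splitGain_sub_one hy h₁ h₂, hd.unique (hasDerivAt_const 1 0), neg_zero]
    · have := splitGain_sub_of_lt_one hp1 hy h₁ h₂
      rw [h p, mul_eq_zero] at this
      refine sub_eq_zero.mp (this.resolve_left ?_)
      have : 0 < (1 - p) * (2 - p) := mul_pos (by linarith) (by linarith)
      exact this.ne'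
  · right
    obtain ⟨Z, hZ, hZ0⟩ := expSum_zeros_finite _ _ h
    refine ⟨fun p => ∑ j, gainCoeff y A₁ B₁ A₂ B₂ j
      * Real.exp (gainExponent y A₁ B₁ A₂ B₂ j * p), insert 1 Z, by fun_prop, ?_, by simp, ?_, ?_⟩
    -- Six zeros at most, and the point `1`.
    · exact (Finset.card_insert_le _ _).trans (by omega)
    · exact fun p hp => Finset.mem_insert_of_mem ((hZ0 p).mp hp)
    · exact fun p hp => splitGain_sub_of_lt_one hp hy h₁ h₂

end Tweedie

/-! ### Comparison of two splits of a tree -/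

section SplitComparison

variable {X : Type*} {n : ℕ}

theorem RegTree.splitObjective_split_sub (p : ℝ) (T : RegTree X) (D : RegDataset X n)
    {a₁ a₂ : List Bool} (h₁ : a₁ ∈ T.leaves) (h₂ : a₂ ∈ T.leaves) (f₁ f₂ : X → Bool) :
    (T.split a₁ f₁).splitObjective p D - (T.split a₂ f₂).splitObjective p D
      = splitGain p (fun i => (D i).2) (T.atChild D a₁ f₁ false) (T.atChild D a₁ f₁ true)
        - splitGain p (fun i => (D i).2) (T.atChild D a₂ f₂ false) (T.atChild D a₂ f₂ true) := by
  rw [splitObjective_split p T D a₁ h₁, splitObjective_split p T D a₂ h₂]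
  ring

theorem RegTree.splitObjective_of_isEmpty (p : ℝ) (T : RegTree X) (D : RegDataset X 0) :
    T.splitObjective p D = 0 := by
  refine Finset.sum_eq_zero fun a _ => ?_
  rw [Finset.eq_empty_of_isEmpty (T.atLeaf D a)]
  simp

theorem exists_expSum_split_sub {C : ℝ} (hC : 7 ≤ C) (D : RegDataset X n) (hD : ∀ i, 0 ≤ (D i).2)
    (T : RegTree X) {a₁ a₂ : List Bool} (h₁ : a₁ ∈ T.leaves) (h₂ : a₂ ∈ T.leaves)
    (f₁ f₂ : X → Bool) :
    ∃ (m : ℕ) (c b : Fin m → ℝ), (m : ℝ) ≤ C * (n : ℝ) ∧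
      ∀ p ∈ Set.Ico (0 : ℝ) 1,
        (1 - p) * (2 - p) * ((T.split a₁ f₁).splitObjective p D
            - (T.split a₂ f₂).splitObjective p D)
          = ∑ j, c j * Real.exp (b j * p) := by
  -- Without examples the bound `C * n` is `0` and the objective vanishes; otherwise six terms are
  -- at most `C * n`.
  rcases Nat.eq_zero_or_pos n with rfl | hn
  · exact ⟨0, fun _ => 0, fun _ => 0, by simp, by simp [RegTree.splitObjective_of_isEmpty]⟩
  · have hn1 : (1 : ℝ) ≤ n := by exact_mod_cast hn
    refine ⟨6, gainCoeff (fun i => (D i).2) (T.atChild D a₁ f₁ false) (T.atChild D a₁ f₁ true)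
      (T.atChild D a₂ f₂ false) (T.atChild D a₂ f₂ true), gainExponent (fun i => (D i).2)
      (T.atChild D a₁ f₁ false) (T.atChild D a₁ f₁ true) (T.atChild D a₂ f₂ false)
      (T.atChild D a₂ f₂ true), by push_cast; nlinarith, fun p hp => ?_⟩
    rw [RegTree.splitObjective_split_sub p T D h₁ h₂]
    exact splitGain_sub_of_lt_one hp.2 hD (T.disjoint_atChild D a₁ f₁) (T.disjoint_atChild D a₂ f₂)

theorem split_eq_or_finite {C : ℝ} (hC : 7 ≤ C) (D : RegDataset X n) (hD : ∀ i, 0 ≤ (D i).2)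
    (T : RegTree X) {a₁ a₂ : List Bool} (h₁ : a₁ ∈ T.leaves) (h₂ : a₂ ∈ T.leaves)
    (f₁ f₂ : X → Bool) :
    (∀ p ∈ Set.Icc (0 : ℝ) 1,
        (T.split a₁ f₁).splitObjective p D = (T.split a₂ f₂).splitObjective p D) ∨
      ({p ∈ Set.Icc (0 : ℝ) 1 |
          (T.split a₁ f₁).splitObjective p D = (T.split a₂ f₂).splitObjective p D}.Finite ∧
        (Set.ncard {p ∈ Set.Icc (0 : ℝ) 1 |
          (T.split a₁ f₁).splitObjective p D = (T.split a₂ f₂).splitObjective p D} : ℝ)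
          ≤ C * (n : ℝ)) := by
  rcases Nat.eq_zero_or_pos n with rfl | hn
  · exact Or.inl fun p _ => by simp only [RegTree.splitObjective_of_isEmpty]
  have hn1 : (1 : ℝ) ≤ n := by exact_mod_cast hn
  have hsub := fun p => RegTree.splitObjective_split_sub p T D h₁ h₂ f₁ f₂
  rcases splitGain_sub_dichotomy (y := fun i => (D i).2) hD (T.disjoint_atChild D a₁ f₁)
    (T.disjoint_atChild D a₂ f₂) with h | ⟨E, Z, -, hZ, h1, hE, hEq⟩
  · left
    intro p hp
    rw [← sub_eq_zero, hsub, h p hp, sub_self]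
  · right
    have hss : {p ∈ Set.Icc (0 : ℝ) 1 |
        (T.split a₁ f₁).splitObjective p D = (T.split a₂ f₂).splitObjective p D} ⊆ ↑Z := by
      rintro p ⟨hp, he⟩
      rcases hp.2.eq_or_lt with rfl | hp1
      · exact h1
      · refine hE p ?_
        rw [← hEq p hp1, ← hsub, he, sub_self, mul_zero]
    refine ⟨Z.finite_toSet.subset hss, ?_⟩
    have hc : Set.ncard {p ∈ Set.Icc (0 : ℝ) 1 |
        (T.split a₁ f₁).splitObjective p D = (T.split a₂ f₂).splitObjective p D} ≤ 7 :=
      (Set.ncard_le_ncard hss Z.finite_toSet).trans (by rwa [Set.ncard_coe_finset])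
    have hc' : (Set.ncard {p ∈ Set.Icc (0 : ℝ) 1 |
        (T.split a₁ f₁).splitObjective p D = (T.split a₂ f₂).splitObjective p D} : ℝ) ≤ 7 := by
      exact_mod_cast hc
    nlinarith

end SplitComparison

/-! ### Step functions of one parameter -/

section StepFunction

/-- `g` is piecewise constant on `[0, 1]`, with at most `K` changes of value: it is determined by a
monotone function with values in `{0, …, K}`. -/
def IsStepFunction {β : Type*} (K : ℕ) (g : ℝ → β) : Prop :=
  ∃ r : ℝ → ℕ, MonotoneOn r (Set.Icc 0 1) ∧ (∀ p ∈ Set.Icc (0 : ℝ) 1, r p ≤ K) ∧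
    ∀ p ∈ Set.Icc (0 : ℝ) 1, ∀ q ∈ Set.Icc (0 : ℝ) 1, r p = r q → g p = g q

theorem eq_of_sum_eq_of_monotoneOn {ι : Type*} [Fintype ι] {r : ι → ℝ → ℕ} {s : Set ℝ}
    (hr : ∀ i, MonotoneOn (r i) s) {p q : ℝ} (hp : p ∈ s) (hq : q ∈ s)
    (h : ∑ i, r i p = ∑ i, r i q) (i : ι) : r i p = r i q := by
  rcases le_total p q with hpq | hpq
  · exact (Finset.sum_eq_sum_iff_of_le fun i _ => hr i hp hq hpq).mp h i (Finset.mem_univ _)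
  · exact ((Finset.sum_eq_sum_iff_of_le fun i _ => hr i hq hp hpq).mp h.symm i
      (Finset.mem_univ _)).symm

namespace IsStepFunction

variable {β γ : Type*} {K : ℕ}

theorem of_eq {g : ℝ → β} {h : ℝ → γ} (hg : IsStepFunction K g)
    (hgh : ∀ p ∈ Set.Icc (0 : ℝ) 1, ∀ q ∈ Set.Icc (0 : ℝ) 1, g p = g q → h p = h q) :
    IsStepFunction K h := by
  obtain ⟨r, hr, hrK, hrg⟩ := hg
  exact ⟨r, hr, hrK, fun p hp q hq hpq => hgh p hp q hq (hrg p hp q hq hpq)⟩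

/-- The sum of the ranks is a rank for the whole vector: monotone ranks cannot compensate each
other, so equal sums force equal summands. The numbers of changes add instead of multiplying. -/
theorem pi {ι : Type*} [Fintype ι] {g : ι → ℝ → β} (hg : ∀ i, IsStepFunction K (g i)) :
    IsStepFunction (Fintype.card ι * K) fun p i => g i p := by
  choose r hr hrK hrg using hg
  refine ⟨fun p => ∑ i, r i p, fun p hp q hq hpq => Finset.sum_le_sum fun i _ => hr i hp hq hpq,
    fun p hp => ?_, fun p hp q hq hpq => funext fun i => hrg i p hp q hq ?_⟩
  · simpa using Finset.sum_le_card_nsmul Finset.univ (fun i => r i p) K fun i _ => hrK i p hp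
  · exact eq_of_sum_eq_of_monotoneOn hr hp hq hpq i

/-- The rank of `p` is the number of breakpoints `< p` plus the number `≤ p`. It separates each
breakpoint from the open intervals on both sides, hence the factor `2`. -/
theorem of_breakpoints {g : ℝ → β} (Z : Finset ℝ)
    (h : ∀ p ∈ Set.Icc (0 : ℝ) 1, ∀ q ∈ Set.Icc (0 : ℝ) 1, p < q →
      (∀ z ∈ Z, z ∉ Set.Icc p q) → g p = g q) : IsStepFunction (2 * Z.card) g := by
  have hlt : ∀ p q, p ≤ q → Z.filter (· < p) ⊆ Z.filter (· < q) := fun p q hpq =>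
    Finset.monotone_filter_right _ fun z _ hz => lt_of_lt_of_le hz hpq
  have hle : ∀ p q, p ≤ q → Z.filter (· ≤ p) ⊆ Z.filter (· ≤ q) := fun p q hpq =>
    Finset.monotone_filter_right _ fun z _ hz => le_trans hz hpq
  have key : ∀ p ∈ Set.Icc (0 : ℝ) 1, ∀ q ∈ Set.Icc (0 : ℝ) 1, p < q →
      (Z.filter (· < p)).card + (Z.filter (· ≤ p)).card
        = (Z.filter (· < q)).card + (Z.filter (· ≤ q)).card → g p = g q := by
    intro p hp q hq hpq he
    have c1 := Finset.card_le_card (hlt p q hpq.le)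
    have c2 := Finset.card_le_card (hle p q hpq.le)
    have e1 := Finset.eq_of_subset_of_card_le (hlt p q hpq.le) (by omega)
    have e2 := Finset.eq_of_subset_of_card_le (hle p q hpq.le) (by omega)
    refine h p hp q hq hpq fun z hz hzpq => ?_
    have h1 := Finset.ext_iff.mp e1 z
    have h2 := Finset.ext_iff.mp e2 z
    simp only [Finset.mem_filter, hz, true_and] at h1 h2
    rcases hzpq.1.eq_or_lt with hzp | hzp
    · exact absurd (h1.mpr (hzp ▸ hpq)) (not_lt.mpr hzpq.1)
    · exact absurd (h2.mpr hzpq.2) (not_le.mpr hzp)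
  refine ⟨fun p => (Z.filter (· < p)).card + (Z.filter (· ≤ p)).card, fun p _ q _ hpq =>
    add_le_add (Finset.card_le_card (hlt p q hpq)) (Finset.card_le_card (hle p q hpq)),
    fun p _ => ?_, fun p hp q hq he => ?_⟩
  · have := Finset.card_filter_le Z (· < p)
    have := Finset.card_filter_le Z (· ≤ p)
    dsimp only
    omega
  · rcases lt_trichotomy p q with hpq | rfl | hpq
    exacts [key p hp q hq hpq he, rfl, (key q hq p hp hpq he.symm).symm]

end IsStepFunction

variable {n : ℕ} {y : Fin n → ℝ} {A₁ B₁ A₂ B₂ : Finset (Fin n)}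

/-- By the intermediate value theorem the sign of the difference can only change across one of the
seven exceptional points, each of which costs two changes. -/
theorem isStepFunction_splitGain_le (hy : ∀ i, 0 ≤ y i) (h₁ : Disjoint A₁ B₁)
    (h₂ : Disjoint A₂ B₂) :
    IsStepFunction 14 fun p => splitGain p y A₁ B₁ ≤ splitGain p y A₂ B₂ := by
  have key : ∃ Z : Finset ℝ, Z.card ≤ 7 ∧ ∀ p ∈ Set.Icc (0 : ℝ) 1, ∀ q ∈ Set.Icc (0 : ℝ) 1, p < q →
      (∀ z ∈ Z, z ∉ Set.Icc p q) → (splitGain p y A₁ B₁ ≤ splitGain p y A₂ B₂)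
        = (splitGain q y A₁ B₁ ≤ splitGain q y A₂ B₂) := by
    rcases splitGain_sub_dichotomy hy h₁ h₂ with h | ⟨E, Z, hEc, hZ, h1, hE, hEq⟩
    · exact ⟨∅, by simp, fun p hp q hq _ _ => by rw [h p hp, h q hq]; simp⟩
    · refine ⟨Z, hZ, fun p hp q hq hpq hno => ?_⟩
      have hq1 : q < 1 := by
        by_contra! hq1
        exact hno 1 h1 ⟨hp.2, hq1⟩
      have hsign : ∀ x < 1, splitGain x y A₁ B₁ ≤ splitGain x y A₂ B₂ ↔ E x ≤ 0 := fun x hx => by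
        have hpos : 0 < (1 - x) * (2 - x) := mul_pos (by linarith) (by linarith)
        rw [← hEq x hx, ← sub_nonpos, mul_nonpos_iff_pos_imp_nonpos]
        constructor
        · exact fun h => ⟨fun _ => h, fun h' => hpos.le⟩
        · exact fun h => h.1 hpos
      rw [hsign p (hpq.trans hq1), hsign q hq1]
      refine propext ⟨fun hp0 => ?_, fun hq0 => ?_⟩
      · by_contra! hq0
        obtain ⟨z, hz, hz0⟩ := intermediate_value_Icc hpq.le hEc.continuousOn ⟨hp0, hq0.le⟩
        exact hno z (hE z hz0) hz
      · by_contra! hp0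
        obtain ⟨z, hz, hz0⟩ := intermediate_value_Icc' hpq.le hEc.continuousOn ⟨hq0, hp0.le⟩
        exact hno z (hE z hz0) hz
  obtain ⟨Z, hZ, h⟩ := key
  obtain ⟨r, hr, hrK, hrg⟩ := IsStepFunction.of_breakpoints Z h
  exact ⟨r, hr, fun p hp => (hrK p hp).trans (by omega), hrg⟩

end StepFunction

/-! ### The learned tree as a step function of the power -/

namespace RegTree

variable {X : Type*} {n : ℕ}

theorem splitObjective_split_le_iff (p : ℝ) (T : RegTree X) (D : RegDataset X n)
    {a₁ a₂ : List Bool} (h₁ : a₁ ∈ T.leaves) (h₂ : a₂ ∈ T.leaves) (f₁ f₂ : X → Bool) :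
    (T.split a₁ f₁).splitObjective p D ≤ (T.split a₂ f₂).splitObjective p D
      ↔ splitGain p (fun i => (D i).2) (T.atChild D a₁ f₁ false) (T.atChild D a₁ f₁ true)
        ≤ splitGain p (fun i => (D i).2) (T.atChild D a₂ f₂ false) (T.atChild D a₂ f₂ true) := by
  rw [← sub_nonpos, splitObjective_split_sub p T D h₁ h₂, sub_nonpos]

/-- The vector of all comparisons, over all quadruples of sets of examples, is a step function. Two
powers with the same vector have the same minimizers for every tree, so the tie-breaking rule takes
the same decision in every round; hence the bound is free of `t` and `F`. -/
theorem isStepFunction_topDown (F : Finset (X → Bool))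
    (tie : RegTree X → Finset (List Bool × (X → Bool)) → List Bool × (X → Bool))
    (D : RegDataset X n) (hD : ∀ i, 0 ≤ (D i).2) (t : ℕ) :
    IsStepFunction (16 ^ n * 14) fun p => topDown F tie p D t := by
  have hpi := IsStepFunction.pi (K := 14)
    (ι := (Fin 4 → Finset (Fin n))) (g := fun S p => Disjoint (S 0) (S 1) → Disjoint (S 2) (S 3) →
      splitGain p (fun i => (D i).2) (S 0) (S 1) ≤ splitGain p (fun i => (D i).2) (S 2) (S 3))
    fun S => by
      -- Quadruples that are not two disjoint pairs carry a vacuously true proposition, constant in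
      -- `p`.
      by_cases h₁ : Disjoint (S 0) (S 1)
      · by_cases h₂ : Disjoint (S 2) (S 3)
        · simpa [h₁, h₂] using isStepFunction_splitGain_le hD h₁ h₂
        · exact ⟨fun _ => 0, by simp [MonotoneOn], by simp, by simp [h₂]⟩
      · exact ⟨fun _ => 0, by simp [MonotoneOn], by simp, by simp [h₁]⟩
  have hcard : Fintype.card (Fin 4 → Finset (Fin n)) = 16 ^ n := by
    simp only [Fintype.card_pi, Fintype.card_finset, Fintype.card_fin, Finset.prod_const,
      Finset.card_univ]
    rw [← pow_mul, mul_comm, pow_mul]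
    norm_num
  rw [hcard] at hpi
  refine hpi.of_eq fun p _ q _ hpq => ?_
  have hcmp : ∀ (T : RegTree X) (c d : List Bool × (X → Bool)), c.1 ∈ T.leaves → d.1 ∈ T.leaves →
      ((T.split c.1 c.2).splitObjective p D ≤ (T.split d.1 d.2).splitObjective p D ↔
        (T.split c.1 c.2).splitObjective q D ≤ (T.split d.1 d.2).splitObjective q D) := by
    intro T c d hc hd
    have h := congrFun hpq ![T.atChild D c.1 c.2 false, T.atChild D c.1 c.2 true,
      T.atChild D d.1 d.2 false, T.atChild D d.1 d.2 true]
    simp only [Matrix.cons_val, disjoint_atChild, forall_true_left] at h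
    rw [splitObjective_split_le_iff p T D hc hd, splitObjective_split_le_iff q T D hc hd, h]
  have hbest : ∀ T : RegTree X, T.bestSplits F p D = T.bestSplits F q D := fun T => by
    refine Finset.filter_congr fun c hc => forall₂_congr fun d hd => hcmp T c d ?_ ?_
    exacts [(Finset.mem_product.mp hc).1, (Finset.mem_product.mp hd).1]
  induction t with
  | zero => rfl
  | succ t ih => simp only [topDown, ih, hbest]

end RegTree

/-! ### Measurability of unions over a parameter -/

/-- `E` is a countable union of sublevel sets of functions that are continuous in the parameter and
measurable in the sample point. -/
def IsSigmaSublevel {P Ω : Type*} [TopologicalSpace P] [MeasurableSpace Ω] (E : P → Set Ω) : Prop :=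
  ∃ (ι : Type) (_ : Countable ι) (h : ι → P → Ω → ℝ), (∀ m ω, Continuous fun p => h m p ω) ∧
    (∀ m p, Measurable (h m p)) ∧ ∀ p ω, ω ∈ E p ↔ ∃ m, h m p ω ≤ 0

namespace IsSigmaSublevel

variable {P Ω Ω' : Type*} [TopologicalSpace P] [MeasurableSpace Ω] [MeasurableSpace Ω']
  {E E' : P → Set Ω}

theorem of_le {h : P → Ω → ℝ} (hc : ∀ ω, Continuous fun p => h p ω) (hm : ∀ p, Measurable (h p)) :
    IsSigmaSublevel fun p => {ω | h p ω ≤ 0} :=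
  ⟨Unit, inferInstance, fun _ => h, fun _ => hc, fun _ => hm, by simp⟩

/-- A strict inequality is a countable union of non-strict ones, `1 / (m + 1) ≤ h`. -/
theorem of_pos {h : P → Ω → ℝ} (hc : ∀ ω, Continuous fun p => h p ω) (hm : ∀ p, Measurable (h p)) :
    IsSigmaSublevel fun p => {ω | 0 < h p ω} := by
  refine ⟨ℕ, inferInstance, fun m p ω => 1 / ((m : ℝ) + 1) - h p ω,
    fun m ω => continuous_const.sub (hc ω), fun m p => (hm p).const_sub _, fun p ω => ?_⟩
  constructor
  · intro h0
    obtain ⟨m, hm⟩ := exists_nat_one_div_lt (show 0 < h p ω from h0)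
    exact ⟨m, by linarith⟩
  · rintro ⟨m, hm⟩
    have : (0 : ℝ) < 1 / ((m : ℝ) + 1) := by positivity
    show 0 < h p ω
    linarith

open Classical in
theorem of_measurableSet {A : Set Ω} (hA : MeasurableSet A) :
    IsSigmaSublevel fun _ : P => A := by
  refine ⟨Unit, inferInstance, fun _ _ ω => if ω ∈ A then 0 else 1, fun _ _ => continuous_const,
    fun _ _ => Measurable.ite hA measurable_const measurable_const, fun p ω => ?_⟩
  by_cases h : ω ∈ A
  · simp [h]
  · simp [h]

theorem union (hE : IsSigmaSublevel E) (hE' : IsSigmaSublevel E') :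
    IsSigmaSublevel fun p => E p ∪ E' p := by
  obtain ⟨ι, _, h, hc, hm, hh⟩ := hE
  obtain ⟨ι', _, h', hc', hm', hh'⟩ := hE'
  refine ⟨ι ⊕ ι', inferInstance, Sum.elim h h', ?_, ?_, ?_⟩
  · rintro (m | m) ω
    exacts [hc m ω, hc' m ω]
  · rintro (m | m) p
    exacts [hm m p, hm' m p]
  · simp [hh, hh']

theorem inter (hE : IsSigmaSublevel E) (hE' : IsSigmaSublevel E') :
    IsSigmaSublevel fun p => E p ∩ E' p := by
  obtain ⟨ι, _, h, hc, hm, hh⟩ := hE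
  obtain ⟨ι', _, h', hc', hm', hh'⟩ := hE'
  refine ⟨ι × ι', inferInstance, fun m p ω => max (h m.1 p ω) (h' m.2 p ω),
    fun m ω => (hc m.1 ω).max (hc' m.2 ω), fun m p => (hm m.1 p).max (hm' m.2 p), fun p ω => ?_⟩
  simp [hh, hh']

theorem biUnion {ι : Type*} (s : Finset ι) {E : ι → P → Set Ω}
    (hE : ∀ i ∈ s, IsSigmaSublevel (E i)) : IsSigmaSublevel fun p => ⋃ i ∈ s, E i p := by
  classical
  induction s using Finset.induction_on with
  | empty => simpa using of_measurableSet (P := P) (MeasurableSet.empty (α := Ω))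
  | insert a s _ ih =>
    simp only [Finset.set_biUnion_insert]
    exact (hE a (Finset.mem_insert_self _ _)).union
      (ih fun i hi => hE i (Finset.mem_insert_of_mem hi))

theorem biInter {ι : Type*} (s : Finset ι) {E : ι → P → Set Ω}
    (hE : ∀ i ∈ s, IsSigmaSublevel (E i)) : IsSigmaSublevel fun p => ⋂ i ∈ s, E i p := by
  classical
  induction s using Finset.induction_on with
  | empty => simpa using of_measurableSet (P := P) (MeasurableSet.univ (α := Ω))
  | insert a s _ ih =>
    simp only [Finset.set_biInter_insert]
    exact (hE a (Finset.mem_insert_self _ _)).inter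
      (ih fun i hi => hE i (Finset.mem_insert_of_mem hi))

theorem preimage (hE : IsSigmaSublevel E) {φ : Ω' → Ω} (hφ : Measurable φ) :
    IsSigmaSublevel fun p => φ ⁻¹' E p := by
  obtain ⟨ι, _, h, hc, hm, hh⟩ := hE
  exact ⟨ι, inferInstance, fun m p ω => h m p (φ ω), fun m ω => hc m (φ ω),
    fun m p => (hm m p).comp hφ, fun p ω => hh p (φ ω)⟩

theorem measurableSet (hE : IsSigmaSublevel E) (p : P) : MeasurableSet (E p) := by
  obtain ⟨ι, _, h, -, hm, hh⟩ := hE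
  have : E p = ⋃ m, {ω | h m p ω ≤ 0} := by
    ext ω
    simp [hh]
  rw [this]
  exact MeasurableSet.iUnion fun m => measurableSet_le (hm m p) measurable_const

/-- The projection of a family of sublevel sets over a compact separable parameter space is
measurable. -/
theorem measurableSet_exists [CompactSpace P] [TopologicalSpace.SeparableSpace P]
    (hE : IsSigmaSublevel E) : MeasurableSet {ω | ∃ p, ω ∈ E p} := by
  rcases isEmpty_or_nonempty P with hP | hP
  · simp
  obtain ⟨ι, _, h, hc, hm, hh⟩ := hE
  -- By compactness a continuous function attains a value `≤ 0` iff its infimum is `≤ 0`, and the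
  -- infimum can be tested on a dense sequence.
  have : {ω | ∃ p, ω ∈ E p} = ⋃ m, ⋂ k : ℕ, ⋃ j : ℕ,
      {ω | h m (TopologicalSpace.denseSeq P j) ω < 1 / ((k : ℝ) + 1)} := by
    ext ω
    simp only [Set.mem_ofPred_eq, Set.mem_iUnion, Set.mem_iInter]
    constructor
    · rintro ⟨p, hp⟩
      obtain ⟨m, hm0⟩ := (hh p ω).mp hp
      refine ⟨m, fun k => ?_⟩
      have hk : (0 : ℝ) < 1 / ((k : ℝ) + 1) := by positivity
      exact (TopologicalSpace.denseRange_denseSeq P).exists_mem_open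
        (isOpen_Iio.preimage (hc m ω)) ⟨p, lt_of_le_of_lt hm0 hk⟩
    · rintro ⟨m, hk⟩
      obtain ⟨p, -, hp⟩ := isCompact_univ.exists_isMinOn Set.univ_nonempty (hc m ω).continuousOn
      refine ⟨p, (hh p ω).mpr ⟨m, ?_⟩⟩
      by_contra! hpos
      obtain ⟨k, hk'⟩ := exists_nat_one_div_lt hpos
      obtain ⟨j, hj⟩ := hk k
      have : h m p ω ≤ h m (TopologicalSpace.denseSeq P j) ω := hp (Set.mem_univ _)
      linarith
  rw [this]
  exact MeasurableSet.iUnion fun m => MeasurableSet.iInter fun k => MeasurableSet.iUnion fun j =>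
    measurableSet_lt (hm m _) measurable_const

end IsSigmaSublevel

/-- `Y` takes finitely many values, each of them on a countable union of sublevel sets. -/
def IsSimpleFamily {P Ω α : Type*} [TopologicalSpace P] [MeasurableSpace Ω] (Y : P → Ω → α) :
    Prop :=
  ∃ s : Finset α, (∀ p ω, Y p ω ∈ s) ∧ ∀ a, IsSigmaSublevel fun p => {ω | Y p ω = a}

namespace IsSimpleFamily

variable {P Ω Ω' α β : Type*} [TopologicalSpace P] [MeasurableSpace Ω] [MeasurableSpace Ω']

theorem const (a : α) : IsSimpleFamily fun (_ : P) (_ : Ω) => a :=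
  ⟨{a}, by simp, fun b => IsSigmaSublevel.of_measurableSet (MeasurableSet.const (a = b))⟩

/-- Both truth values have to be treated, since the class of families `IsSigmaSublevel` is not
evidently closed under complements. -/
theorem of_prop {Y : P → Ω → Prop} (h : IsSigmaSublevel fun p => {ω | Y p ω})
    (h' : IsSigmaSublevel fun p => {ω | ¬ Y p ω}) : IsSimpleFamily Y := by
  classical
  refine ⟨{True, False}, fun p ω => by by_cases hY : Y p ω <;> simp [hY], fun a => ?_⟩
  by_cases ha : a
  · simpa [ha] using h
  · simpa [ha] using h'

theorem of_le {h : P → Ω → ℝ} (hc : ∀ ω, Continuous fun p => h p ω) (hm : ∀ p, Measurable (h p)) :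
    IsSimpleFamily fun p ω => h p ω ≤ 0 :=
  of_prop (IsSigmaSublevel.of_le hc hm) (by simpa using IsSigmaSublevel.of_pos hc hm)

theorem of_measurableSet {A : Set Ω} (hA : MeasurableSet A) :
    IsSimpleFamily fun (_ : P) ω => ω ∈ A :=
  of_prop (IsSigmaSublevel.of_measurableSet hA) (IsSigmaSublevel.of_measurableSet hA.compl)

theorem comp {Y : P → Ω → α} (hY : IsSimpleFamily Y) {φ : Ω' → Ω} (hφ : Measurable φ) :
    IsSimpleFamily fun p ω => Y p (φ ω) := by
  obtain ⟨s, hs, h⟩ := hY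
  exact ⟨s, fun p ω => hs p (φ ω), fun a => (h a).preimage hφ⟩

/-- Case distinction over the finitely many values of `Y`. The invariant `A` restricts what has to
be known of `Z`; below it says that the node functions of a tree belong to `F` and so are
measurable. -/
theorem bind {Y : P → Ω → α} (hY : IsSimpleFamily Y) {A : Set α} (hA : ∀ p ω, Y p ω ∈ A)
    {Z : α → P → Ω → β} (hZ : ∀ a ∈ A, IsSimpleFamily (Z a)) :
    IsSimpleFamily fun p ω => Z (Y p ω) p ω := by
  classical
  obtain ⟨s, hs, h⟩ := hY
  choose! u hu hu' using hZ
  refine ⟨(s.filter (· ∈ A)).biUnion u, fun p ω => ?_, fun b => ?_⟩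
  · exact Finset.mem_biUnion.mpr ⟨_, Finset.mem_filter.mpr ⟨hs p ω, hA p ω⟩, hu _ (hA p ω) p ω⟩
  · have : (fun p => {ω | Z (Y p ω) p ω = b})
        = fun p => ⋃ a ∈ s.filter (· ∈ A), {ω | Y p ω = a} ∩ {ω | Z a p ω = b} := by
      ext p ω
      simp only [Set.mem_ofPred_eq, Set.mem_iUnion, Set.mem_inter_iff, Finset.mem_filter,
        exists_prop]
      constructor
      · exact fun hb => ⟨_, ⟨hs p ω, hA p ω⟩, rfl, hb⟩
      · rintro ⟨a, -, rfl, hb⟩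
        exact hb
    rw [this]
    exact IsSigmaSublevel.biUnion _ fun a ha =>
      (h a).inter (hu' a (Finset.mem_filter.mp ha).2 b)

theorem map {Y : P → Ω → α} (hY : IsSimpleFamily Y) (f : α → β) :
    IsSimpleFamily fun p ω => f (Y p ω) :=
  hY.bind (A := Set.univ) (fun _ _ => Set.mem_univ _) (Z := fun a _ _ => f a) fun a _ => const (f a)

theorem pi {ι : Type*} [Fintype ι] {Y : ι → P → Ω → α} (hY : ∀ i, IsSimpleFamily (Y i)) :
    IsSimpleFamily fun p ω i => Y i p ω := by
  classical
  choose s hs h using hY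
  refine ⟨Fintype.piFinset s, fun p ω => Fintype.mem_piFinset.mpr fun i => hs i p ω, fun a => ?_⟩
  have : (fun p => {ω | (fun i => Y i p ω) = a})
      = fun p => ⋂ i ∈ (Finset.univ : Finset ι), {ω | Y i p ω = a i} := by
    ext p ω
    simp [funext_iff]
  rw [this]
  exact IsSigmaSublevel.biInter _ fun i _ => h i (a i)

theorem isSigmaSublevel {Y : P → Ω → Prop} (hY : IsSimpleFamily Y) :
    IsSigmaSublevel fun p => {ω | Y p ω} := by
  obtain ⟨s, -, h⟩ := hY
  simpa using h True

end IsSimpleFamily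

theorem measurable_apply_of_finite {Ω ι β : Type*} [MeasurableSpace Ω] [MeasurableSpace β]
    {f : Ω → ι} (s : Finset ι) (hs : ∀ ω, f ω ∈ s)
    (hf : ∀ i ∈ s, MeasurableSet {ω | f ω = i}) {g : ι → Ω → β} (hg : ∀ i ∈ s, Measurable (g i)) :
    Measurable fun ω => g (f ω) ω := by
  intro B hB
  have : (fun ω => g (f ω) ω) ⁻¹' B = ⋃ i ∈ s, {ω | f ω = i} ∩ g i ⁻¹' B := by
    ext ω
    simp only [Set.mem_preimage, Set.mem_iUnion, Set.mem_inter_iff, Set.mem_ofPred_eq, exists_prop]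
    constructor
    · exact fun h => ⟨_, hs ω, rfl, h⟩
    · rintro ⟨i, -, rfl, h⟩
      exact h
  rw [this]
  exact s.measurableSet_biUnion fun i hi => (hf i hi).inter (hg i hi hB)

theorem measurable_apply_finset {Ω β : Type*} [MeasurableSpace Ω] [MeasurableSpace β] {n : ℕ}
    {S : Ω → Finset (Fin n)} (hS : ∀ i, MeasurableSet {ω | i ∈ S ω}) {g : Finset (Fin n) → Ω → β}
    (hg : ∀ A, Measurable (g A)) : Measurable fun ω => g (S ω) ω := by
  refine measurable_apply_of_finite Finset.univ (fun _ => Finset.mem_univ _) (fun A _ => ?_)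
    fun A _ => hg A
  have : {ω | S ω = A} = ⋂ i, {ω | i ∈ S ω ↔ i ∈ A} := by
    ext ω
    simp [Finset.ext_iff]
  rw [this]
  refine MeasurableSet.iInter fun i => ?_
  by_cases hi : i ∈ A
  · simpa [hi] using hS i
  · have : {ω | i ∈ S ω ↔ i ∈ A} = {ω | i ∈ S ω}ᶜ := by
      ext ω
      simp [hi]
    rw [this]
    exact (hS i).compl

/-! ### Measurability of the learned tree and of its loss -/

namespace RegTree

variable {X : Type*} {n : ℕ}

/-- All node functions of the tree belong to `F`. -/
def NodesIn (F : Finset (X → Bool)) : RegTree X → Prop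
  | leaf => True
  | node f l r => f ∈ F ∧ l.NodesIn F ∧ r.NodesIn F

theorem NodesIn.split {F : Finset (X → Bool)} {T : RegTree X} (hT : T.NodesIn F) (a : List Bool)
    {f : X → Bool} (hf : f ∈ F) : (T.split a f).NodesIn F := by
  induction T generalizing a with
  | leaf => cases a <;> simp [RegTree.split, NodesIn, hf]
  | node g l r ihl ihr =>
    obtain ⟨hg, hl, hr⟩ := hT
    rcases a with _ | ⟨_ | _, a⟩
    exacts [⟨hg, hl, hr⟩, ⟨hg, ihl hl a, hr⟩, ⟨hg, hl, ihr hr a⟩]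

variable {F : Finset (X → Bool)}
  {tie : RegTree X → Finset (List Bool × (X → Bool)) → List Bool × (X → Bool)}

theorem bestSplits_nonempty (hF : F.Nonempty) (p : ℝ) (D : RegDataset X n) (T : RegTree X) :
    (T.bestSplits F p D).Nonempty := by
  obtain ⟨c, hc, hmin⟩ := (T.candidates F).exists_min_image
    (fun c => (T.split c.1 c.2).splitObjective p D) (T.leaves_nonempty.product hF)
  exact ⟨c, Finset.mem_filter.mpr ⟨hc, hmin⟩⟩

theorem tie_mem_candidates (hF : F.Nonempty) (htie : ∀ T s, s.Nonempty → tie T s ∈ s) (p : ℝ)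
    (D : RegDataset X n) (T : RegTree X) : tie T (T.bestSplits F p D) ∈ T.candidates F :=
  (Finset.mem_filter.mp (htie T _ (bestSplits_nonempty hF p D T))).1

theorem nodesIn_topDown (hF : F.Nonempty) (htie : ∀ T s, s.Nonempty → tie T s ∈ s) (p : ℝ)
    (D : RegDataset X n) (t : ℕ) : (topDown F tie p D t).NodesIn F := by
  induction t with
  | zero => trivial
  | succ t ih => exact ih.split _ (Finset.mem_product.mp (tie_mem_candidates hF htie p D _)).2

/-- The learned tree is, independently of the power and the instance, one of finitely many. -/
theorem exists_finset_topDown (hF : F.Nonempty) (htie : ∀ T s, s.Nonempty → tie T s ∈ s) (n t : ℕ) :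
    ∃ s : Finset (RegTree X), ∀ (p : ℝ) (D : RegDataset X n), topDown F tie p D t ∈ s := by
  classical
  induction t with
  | zero => exact ⟨{leaf}, fun p D => Finset.mem_singleton_self _⟩
  | succ t ih =>
    obtain ⟨s, hs⟩ := ih
    exact ⟨s.biUnion fun T => (T.candidates F).image fun c => T.split c.1 c.2, fun p D =>
      Finset.mem_biUnion.mpr ⟨_, hs p D, Finset.mem_image.mpr
        ⟨_, tie_mem_candidates hF htie p D _, rfl⟩⟩⟩

section Measurability

variable [MeasurableSpace X]

theorem NodesIn.measurableSet_route {T : RegTree X} (hT : T.NodesIn F)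
    (hF : ∀ f ∈ F, Measurable f) (a : List Bool) : MeasurableSet {x | T.route x = a} := by
  induction T generalizing a with
  | leaf =>
    simp only [route]
    exact MeasurableSet.const ([] = a)
  | node f l r ihl ihr =>
    obtain ⟨hf, hl, hr⟩ := hT
    have hft : MeasurableSet {x | f x = true} := hF f hf (measurableSet_singleton true)
    have hA : ∀ (v : Bool) (T : RegTree X), (∀ a, MeasurableSet {x | T.route x = a}) →
        MeasurableSet {x | v :: T.route x = a} := fun v T hT => by
      rcases a with _ | ⟨w, a⟩
      · simp
      · simp only [List.cons.injEq]
        exact (MeasurableSet.const (v = w)).inter (hT a)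
    have : {x | (node f l r).route x = a} = ({x | f x = true} ∩ {x | true :: r.route x = a})
        ∪ ({x | f x = true}ᶜ ∩ {x | false :: l.route x = a}) := by
      ext x
      cases h : f x <;> simp [route, h]
    rw [this]
    exact (hft.inter (hA true r (ihr hr))).union (hft.compl.inter (hA false l (ihl hl)))

theorem measurable_label (i : Fin n) : Measurable fun D : RegDataset X n => (D i).2 :=
  measurable_snd.comp (measurable_pi_apply i)

theorem measurable_input (i : Fin n) : Measurable fun D : RegDataset X n => (D i).1 :=
  measurable_fst.comp (measurable_pi_apply i)

theorem measurable_labelMean (S : Finset (Fin n)) :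
    Measurable fun D : RegDataset X n => labelMean (fun i => (D i).2) S :=
  (Finset.measurable_fun_sum S fun i _ => measurable_label i).div_const _

theorem measurable_tweedieDeviance (p : ℝ) (S : Finset (Fin n)) :
    Measurable fun D : RegDataset X n => tweedieDeviance p (fun i => (D i).2) S := by
  have hm := measurable_labelMean (X := X) S
  have hy := fun i => measurable_label (X := X) (n := n) i
  unfold tweedieDeviance
  split_ifs
  · refine Measurable.const_mul (Finset.measurable_fun_sum S fun i _ => ?_) _
    have := hy i
    exact ((this.mul (this.div hm).log).sub this).add hm
  · refine Measurable.const_mul (Finset.measurable_fun_sum S fun i _ => ?_) _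
    have := hy i
    exact ((((this.max measurable_const).pow_const _).div_const _).sub
      ((this.mul (hm.pow_const _)).div_const _)).add ((hm.pow_const _).div_const _)

theorem NodesIn.measurable_splitObjective {T : RegTree X} (hT : T.NodesIn F)
    (hF : ∀ f ∈ F, Measurable f) (p : ℝ) :
    Measurable fun D : RegDataset X n => T.splitObjective p D := by
  refine Finset.measurable_fun_sum _ fun a _ => ?_
  refine measurable_apply_finset (S := fun D : RegDataset X n => T.atLeaf D a)
    (g := fun A D => (A.card : ℝ) * tweedieDeviance p (fun i => (D i).2) A) (fun i => ?_)
    fun A => (measurable_tweedieDeviance p A).const_mul _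
  simpa [atLeaf] using measurable_input i (hT.measurableSet_route hF a)

theorem NodesIn.measurable_predict {T : RegTree X} (hT : T.NodesIn F)
    (hF : ∀ f ∈ F, Measurable f) (i : Fin n) :
    Measurable fun D : RegDataset X n => T.predict D (D i).1 := by
  refine measurable_apply_finset (S := fun D : RegDataset X n => T.atLeaf D (T.route (D i).1))
    (g := fun A D => labelMean (fun i => (D i).2) A) (fun j => ?_) measurable_labelMean
  have : {D : RegDataset X n | j ∈ T.atLeaf D (T.route (D i).1)} = ⋃ a ∈ T.leaves,
      {D : RegDataset X n | T.route (D i).1 = a} ∩ {D : RegDataset X n | T.route (D j).1 = a} := by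
    ext D
    simp only [atLeaf, Finset.mem_filter, Finset.mem_univ, true_and, Set.mem_ofPred_eq,
      Set.mem_iUnion, Set.mem_inter_iff, exists_prop]
    constructor
    · exact fun h => ⟨_, T.route_mem_leaves _, rfl, h⟩
    · rintro ⟨a, -, rfl, h⟩
      exact h
  rw [this]
  exact T.leaves.measurableSet_biUnion fun a _ =>
    (measurable_input i (hT.measurableSet_route hF a)).inter
      (measurable_input j (hT.measurableSet_route hF a))

theorem NodesIn.measurable_loss {T : RegTree X} (hT : T.NodesIn F) (hF : ∀ f ∈ F, Measurable f)
    {ℓ : ℝ → ℝ → ℝ} (hℓ : Measurable (Function.uncurry ℓ)) :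
    Measurable fun D : RegDataset X n => T.loss ℓ D :=
  Measurable.const_mul (Finset.measurable_fun_sum _ fun i _ =>
    hℓ.comp ((hT.measurable_predict hF i).prodMk (measurable_label i))) _

end Measurability

/-- Only powers below `1` are covered; `p = 1` is treated later as a parameter space with one point.
-/
theorem continuousOn_splitObjective (T : RegTree X) (D : RegDataset X n) :
    ContinuousOn (fun p => T.splitObjective p D) (Set.Iio 1) := by
  have key : ∀ p ∈ Set.Iio (1 : ℝ), ContinuousAt (fun p : ℝ => ∑ a ∈ T.leaves,
      ((T.atLeaf D a).card : ℝ) * (2 / ((T.atLeaf D a).card : ℝ) * ∑ i ∈ T.atLeaf D a,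
        ((max (D i).2 0) ^ (2 - p) / ((1 - p) * (2 - p))
          - (D i).2 * (labelMean (fun i => (D i).2) (T.atLeaf D a)) ^ (1 - p) / (1 - p)
          + (labelMean (fun i => (D i).2) (T.atLeaf D a)) ^ (2 - p) / (2 - p)))) p := by
    intro p hp
    have hp : p < 1 := hp
    have h1 : 1 - p ≠ 0 := by linarith
    have h2 : 2 - p ≠ 0 := by linarith
    have c1 : ContinuousAt (fun p : ℝ => 1 - p) p := by fun_prop
    have c2 : ContinuousAt (fun p : ℝ => 2 - p) p := by fun_prop
    -- The base may be `0`, and `0 ^ s` is continuous in `s` only away from `s = 0`.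
    have r1 : ∀ x : ℝ, ContinuousAt (fun p : ℝ => x ^ (1 - p)) p := fun x =>
      (Real.continuousAt_const_rpow' h1).comp c1
    have r2 : ∀ x : ℝ, ContinuousAt (fun p : ℝ => x ^ (2 - p)) p := fun x =>
      (Real.continuousAt_const_rpow' h2).comp c2
    refine tendsto_finsetSum _ fun a _ => ContinuousAt.mul continuousAt_const
      (ContinuousAt.mul continuousAt_const (tendsto_finsetSum _ fun i _ => ?_))
    exact (((r2 _).div (c1.mul c2) (mul_ne_zero h1 h2)).sub
      ((continuousAt_const.mul (r1 _)).div c1 h1)).add ((r2 _).div c2 h2)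
  refine (continuousOn_of_forall_continuousAt key).congr fun p hp => ?_
  simp only [splitObjective, tweedieDeviance, if_neg (ne_of_lt (show p < 1 from hp))]

section SimpleFamily

variable [MeasurableSpace X] {P : Type*} [TopologicalSpace P] {ρ : P → ℝ}

/-- The set of minimizers is a function of the finite table of pairwise comparisons, each of which
is a sublevel condition. -/
theorem NodesIn.isSimpleFamily_bestSplits {T : RegTree X} (hT : T.NodesIn F)
    (hF : ∀ f ∈ F, Measurable f)
    (hρ : ∀ (T : RegTree X) (D : RegDataset X n), Continuous fun p => T.splitObjective (ρ p) D) :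
    IsSimpleFamily fun p (D : RegDataset X n) => T.bestSplits F (ρ p) D := by
  classical
  have hcmp := IsSimpleFamily.pi (P := P) (Ω := RegDataset X n)
    (ι := T.candidates F × T.candidates F) (Y := fun c p D =>
      (T.split c.1.1.1 c.1.1.2).splitObjective (ρ p) D
        - (T.split c.2.1.1 c.2.1.2).splitObjective (ρ p) D ≤ 0) fun c => by
      refine IsSimpleFamily.of_le (fun D => (hρ _ D).sub (hρ _ D)) fun p => ?_
      exact ((hT.split _ (Finset.mem_product.mp c.1.2).2).measurable_splitObjective hF _).sub
        ((hT.split _ (Finset.mem_product.mp c.2.2).2).measurable_splitObjective hF _)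
  convert! hcmp.map fun Y => (T.candidates F).filter fun c => ∀ (d) (hd : d ∈ T.candidates F)
    (hc : c ∈ T.candidates F), Y (⟨c, hc⟩, ⟨d, hd⟩) using 4 with p D
  ext c
  simp only [bestSplits, Finset.mem_filter, sub_nonpos]
  exact and_congr_right fun hc => ⟨fun h d hd _ => h d hd, fun h d hd => h d hd hc⟩

theorem isSimpleFamily_topDown (hne : F.Nonempty) (hF : ∀ f ∈ F, Measurable f)
    (htie : ∀ T s, s.Nonempty → tie T s ∈ s)
    (hρ : ∀ (T : RegTree X) (D : RegDataset X n), Continuous fun p => T.splitObjective (ρ p) D)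
    (t : ℕ) : IsSimpleFamily fun p (D : RegDataset X n) => topDown F tie (ρ p) D t := by
  induction t with
  | zero => exact IsSimpleFamily.const _
  | succ t ih =>
    exact ih.bind (A := {T | T.NodesIn F}) (fun p D => nodesIn_topDown hne htie _ D t)
      (Z := fun T p D => T.split (tie T (T.bestSplits F (ρ p) D)).1
        (tie T (T.bestSplits F (ρ p) D)).2)
      fun T hT => (NodesIn.isSimpleFamily_bestSplits hT hF hρ).map
        fun s => T.split (tie T s).1 (tie T s).2

end SimpleFamily

end RegTree

section Measurability

variable {X : Type*} [MeasurableSpace X] {n : ℕ} {F : Finset (X → Bool)}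
  {tie : RegTree X → Finset (List Bool × (X → Bool)) → List Bool × (X → Bool)} {ℓ : ℝ → ℝ → ℝ}

theorem measurable_tweedieLoss (hne : F.Nonempty) (hF : ∀ f ∈ F, Measurable f)
    (htie : ∀ T s, s.Nonempty → tie T s ∈ s) (hℓ : Measurable (Function.uncurry ℓ)) (t : ℕ) (p : ℝ) :
    Measurable (tweedieLoss F tie t ℓ p : RegDataset X n → ℝ) := by
  classical
  obtain ⟨s, hs, h⟩ := RegTree.isSimpleFamily_topDown (P := Unit) (ρ := fun _ => p) (n := n) hne hF
    htie (fun T D => continuous_const) t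
  refine measurable_apply_of_finite (f := fun D => RegTree.topDown F tie p D t)
    (g := fun T D => T.loss ℓ D) (s.filter fun T => T.NodesIn F) (fun D => ?_)
    (fun T _ => (h T).measurableSet ()) fun T hT => ?_
  · exact Finset.mem_filter.mpr ⟨hs () D, RegTree.nodesIn_topDown hne htie p D t⟩
  · exact (Finset.mem_filter.mp hT).2.measurable_loss hF hℓ

theorem isSigmaSublevel_sum_tweedieLoss {P : Type*} [TopologicalSpace P] {ρ : P → ℝ}
    (hne : F.Nonempty) (hF : ∀ f ∈ F, Measurable f) (htie : ∀ T s, s.Nonempty → tie T s ∈ s)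
    (hℓ : Measurable (Function.uncurry ℓ)) (t : ℕ)
    (hρ : ∀ (T : RegTree X) (D : RegDataset X n), Continuous fun p => T.splitObjective (ρ p) D)
    (N : ℕ) (c : ℝ) :
    IsSigmaSublevel fun p => {z : Fin N → RegDataset X n × RegDataset X n |
      c < |∑ j, (tweedieLoss F tie t ℓ (ρ p) (z j).1 - tweedieLoss F tie t ℓ (ρ p) (z j).2)|} := by
  have hT := RegTree.isSimpleFamily_topDown hne hF htie hρ t
  have hpi : IsSimpleFamily fun p (z : Fin N → RegDataset X n × RegDataset X n) (j : Fin N) =>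
      (RegTree.topDown F tie (ρ p) (z j).1 t, RegTree.topDown F tie (ρ p) (z j).2 t) :=
    IsSimpleFamily.pi fun j =>
      ((hT.comp (measurable_fst.comp (measurable_pi_apply j))).bind (A := Set.univ)
        (fun _ _ => Set.mem_univ _)
        (Z := fun T p (z : Fin N → RegDataset X n × RegDataset X n) =>
          (T, RegTree.topDown F tie (ρ p) (z j).2 t))
        fun T _ => (hT.comp (measurable_snd.comp (measurable_pi_apply j))).map fun T' => (T, T'))
  refine (hpi.bind (A := {τ | ∀ j, (τ j).1.NodesIn F ∧ (τ j).2.NodesIn F}) (fun p z j =>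
    ⟨RegTree.nodesIn_topDown hne htie _ _ t, RegTree.nodesIn_topDown hne htie _ _ t⟩)
    (Z := fun τ _ z => c < |∑ j, ((τ j).1.loss ℓ (z j).1 - (τ j).2.loss ℓ (z j).2)|)
    fun τ hτ => IsSimpleFamily.of_measurableSet (A := {z : Fin N → RegDataset X n × RegDataset X n |
      c < |∑ j, ((τ j).1.loss ℓ (z j).1 - (τ j).2.loss ℓ (z j).2)|}) ?_).isSigmaSublevel
  refine measurableSet_lt measurable_const ?_
  have : Measurable fun z : Fin N → RegDataset X n × RegDataset X n =>
      ∑ j, ((τ j).1.loss ℓ (z j).1 - (τ j).2.loss ℓ (z j).2) :=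
    Finset.measurable_fun_sum _ fun j _ =>
      (((hτ j).1.measurable_loss hF hℓ).comp (measurable_fst.comp (measurable_pi_apply j))).sub
        (((hτ j).2.measurable_loss hF hℓ).comp (measurable_snd.comp (measurable_pi_apply j)))
  exact this.abs

/-- The interval is exhausted by `{1}` and the compact intervals `[0, 1 - 1 / (k + 1)]`, on each of
which the objective is continuous in the power. -/
theorem measurableSet_exists_lt_sum_tweedieLoss (hne : F.Nonempty) (hF : ∀ f ∈ F, Measurable f)
    (htie : ∀ T s, s.Nonempty → tie T s ∈ s) (hℓ : Measurable (Function.uncurry ℓ)) (t N : ℕ)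
    (c : ℝ) :
    MeasurableSet {z : Fin N → RegDataset X n × RegDataset X n | ∃ p ∈ Set.Icc (0 : ℝ) 1,
      c < |∑ j, (tweedieLoss F tie t ℓ p (z j).1 - tweedieLoss F tie t ℓ p (z j).2)|} := by
  have h1 := (isSigmaSublevel_sum_tweedieLoss (n := n) (P := Unit) (ρ := fun _ => 1) hne hF htie hℓ
    t (fun T D => continuous_const) N c).measurableSet_exists
  have h2 := fun k : ℕ => (isSigmaSublevel_sum_tweedieLoss (n := n)
    (P := Set.Icc (0 : ℝ) (1 - 1 / ((k : ℝ) + 1))) (ρ := Subtype.val) hne hF htie hℓ t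
    (fun T D => ((RegTree.continuousOn_splitObjective T D).comp_continuous continuous_subtype_val
      fun p => lt_of_le_of_lt p.2.2 (sub_lt_self _ (by positivity)))) N c).measurableSet_exists
  convert! h1.union (MeasurableSet.iUnion h2) using 1
  ext z
  simp only [Set.mem_union, Set.mem_iUnion, Set.mem_ofPred_eq, Subtype.exists, exists_prop]
  constructor
  · rintro ⟨p, hp, h⟩
    rcases hp.2.eq_or_lt with rfl | hp1
    · exact Or.inl ⟨(), h⟩
    · obtain ⟨k, hk⟩ := exists_nat_one_div_lt (sub_pos.mpr hp1)
      exact Or.inr ⟨k, p, ⟨hp.1, by linarith⟩, h⟩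
  · rintro (⟨_, h⟩ | ⟨k, p, hp, h⟩)
    · exact ⟨1, ⟨zero_le_one, le_rfl⟩, h⟩
    · have : (0 : ℝ) < 1 / ((k : ℝ) + 1) := by positivity
      exact ⟨p, ⟨hp.1, by linarith [hp.2]⟩, h⟩

end Measurability

/-! ### Signed sums and chaining along a rank -/

section Chaining

/-- The sign `-1` for `true` and `1` for `false`. -/
def boolSign (b : Bool) : ℝ := if b then -1 else 1

/-- The signed sum of the coordinates of `x`. -/
def signedSum {N : ℕ} (σ : Fin N → Bool) (x : Fin N → ℝ) : ℝ := ∑ j, boolSign (σ j) * x j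

variable {N : ℕ}

theorem signedSum_sub (σ : Fin N → Bool) (x y : Fin N → ℝ) :
    signedSum σ (x - y) = signedSum σ x - signedSum σ y := by
  simp [signedSum, mul_sub, Finset.sum_sub_distrib]

theorem signedSum_neg (σ : Fin N → Bool) (x : Fin N → ℝ) :
    signedSum σ (-x) = -signedSum σ x := by
  simp [signedSum]

/-- The sum over signs factors into a product of `2 * cosh (x j)`, and `cosh x ≤ exp (x ^ 2 / 2)`.
-/
theorem sum_exp_signedSum_le (x : Fin N → ℝ) :
    ∑ σ : Fin N → Bool, Real.exp (signedSum σ x) ≤ 2 ^ N * Real.exp ((∑ j, x j ^ 2) / 2) := by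
  have h : ∑ σ : Fin N → Bool, Real.exp (signedSum σ x)
      = ∏ j, ∑ b : Bool, Real.exp (boolSign b * x j) := by
    rw [Finset.prod_univ_sum, Fintype.piFinset_univ]
    exact Finset.sum_congr rfl fun σ _ => by rw [signedSum, Real.exp_sum]
  have h2 : (2 : ℝ) ^ N = ∏ _j : Fin N, (2 : ℝ) := by simp
  rw [h, h2, Finset.sum_div, Real.exp_sum, ← Finset.prod_mul_distrib]
  refine Finset.prod_le_prod (fun j _ => Finset.sum_nonneg fun b _ => (Real.exp_pos _).le)
    fun j _ => ?_
  have := Real.cosh_le_exp_half_sq (x j)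
  rw [Real.cosh_eq] at this
  simp only [Fintype.univ_bool, Finset.mem_singleton, Bool.true_eq_false, not_false_eq_true,
    Finset.sum_insert, Finset.sum_singleton, boolSign, if_true]
  norm_num
  linarith

theorem card_lt_signedSum_le (x : Fin N → ℝ) {s v : ℝ} (hs : 0 ≤ s) (hv : 0 < v)
    (hx : ∑ j, x j ^ 2 ≤ v) :
    ((Finset.univ.filter fun σ : Fin N → Bool => s < signedSum σ x).card : ℝ)
      ≤ 2 ^ N * Real.exp (-(s ^ 2 / (2 * v))) := by
  -- The minimizer of the Chernoff exponent `u ^ 2 * v / 2 - u * s`.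
  set u := s / v
  have hu : 0 ≤ u := div_nonneg hs hv.le
  have h1 : ((Finset.univ.filter fun σ : Fin N → Bool => s < signedSum σ x).card : ℝ)
      * Real.exp (u * s) ≤ 2 ^ N * Real.exp (u ^ 2 * v / 2) := by
    calc ((Finset.univ.filter fun σ : Fin N → Bool => s < signedSum σ x).card : ℝ)
          * Real.exp (u * s)
        = ∑ σ ∈ Finset.univ.filter fun σ : Fin N → Bool => s < signedSum σ x,
            Real.exp (u * s) := by rw [Finset.sum_const, nsmul_eq_mul]
      _ ≤ ∑ σ ∈ Finset.univ.filter fun σ : Fin N → Bool => s < signedSum σ x,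
            Real.exp (signedSum σ fun j => u * x j) := by
          refine Finset.sum_le_sum fun σ hσ => Real.exp_le_exp.mpr ?_
          have : (signedSum σ fun j => u * x j) = u * signedSum σ x := by
            simp only [signedSum, Finset.mul_sum]
            exact Finset.sum_congr rfl fun j _ => by ring
          rw [this]
          exact mul_le_mul_of_nonneg_left (Finset.mem_filter.mp hσ).2.le hu
      _ ≤ ∑ σ : Fin N → Bool, Real.exp (signedSum σ fun j => u * x j) :=
          Finset.sum_le_sum_of_subset_of_nonneg (Finset.filter_subset _ _)
            fun σ _ _ => (Real.exp_pos _).le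
      _ ≤ 2 ^ N * Real.exp ((∑ j, (u * x j) ^ 2) / 2) := sum_exp_signedSum_le _
      _ ≤ 2 ^ N * Real.exp (u ^ 2 * v / 2) := by
          refine mul_le_mul_of_nonneg_left (Real.exp_le_exp.mpr ?_) (by positivity)
          simp only [mul_pow, ← Finset.mul_sum]
          gcongr
  have h2 : Real.exp (-(s ^ 2 / (2 * v))) = Real.exp (u ^ 2 * v / 2) / Real.exp (u * s) := by
    rw [← Real.exp_sub]
    congr 1
    simp only [u]
    field_simp
    ring
  rw [h2, mul_div_assoc', le_div_iff₀ (Real.exp_pos _)]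
  exact h1

/-- **Hoeffding's inequality** for signed sums with uniformly distributed signs. -/
theorem card_lt_abs_signedSum_le (x : Fin N → ℝ) {s v : ℝ} (hs : 0 ≤ s) (hv : 0 < v)
    (hx : ∑ j, x j ^ 2 ≤ v) :
    ((Finset.univ.filter fun σ : Fin N → Bool => s < |signedSum σ x|).card : ℝ)
      ≤ 2 ^ N * (2 * Real.exp (-(s ^ 2 / (2 * v)))) := by
  classical
  have hsub : (Finset.univ.filter fun σ : Fin N → Bool => s < |signedSum σ x|)
      ⊆ (Finset.univ.filter fun σ : Fin N → Bool => s < signedSum σ x)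
        ∪ Finset.univ.filter fun σ : Fin N → Bool => s < signedSum σ (-x) := by
    intro σ
    simp [signedSum_neg, lt_abs]
  have hc : ((Finset.univ.filter fun σ : Fin N → Bool => s < |signedSum σ x|).card : ℝ)
      ≤ (Finset.univ.filter fun σ : Fin N → Bool => s < signedSum σ x).card
        + (Finset.univ.filter fun σ : Fin N → Bool => s < signedSum σ (-x)).card := by
    exact_mod_cast (Finset.card_le_card hsub).trans (Finset.card_union_le _ _)
  have h1 := card_lt_signedSum_le x hs hv hx
  have h2 := card_lt_signedSum_le (-x) hs hv (by simpa using hx)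
  linarith

theorem sum_range_pow_sub_le {c : ℝ} (hc : 0 ≤ c) (hc1 : c < 1) (m : ℕ) :
    ∑ k ∈ Finset.range m, c ^ (m - k) ≤ c / (1 - c) := by
  have h1 : 0 < 1 - c := by linarith
  induction m with
  | zero => simpa using div_nonneg hc h1.le
  | succ m ih =>
    rw [Finset.sum_range_succ, Finset.sum_congr rfl (g := fun k => c * c ^ (m - k))
      fun k hk => by rw [Nat.succ_sub (Finset.mem_range.mp hk).le, pow_succ'], ← Finset.mul_sum]
    have : c / (1 - c) = c * (c / (1 - c)) + c := by
      field_simp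
      ring
    rw [this, Nat.add_sub_cancel_left, pow_one]
    gcongr

variable {P : Type*} [Nonempty P]

/-- A point whose rank lies in the dyadic block `b` of length `2 ^ k`, if there is one. -/
noncomputable def blockRep (R : P → ℕ) (k b : ℕ) : P := Function.invFun (fun q => R q / 2 ^ k) b

theorem blockRep_div (R : P → ℕ) (k : ℕ) (q : P) : R (blockRep R k (R q / 2 ^ k)) / 2 ^ k
    = R q / 2 ^ k :=
  Function.invFun_eq (f := fun q => R q / 2 ^ k) ⟨q, rfl⟩

theorem abs_sub_le_of_div_eq {x y c : ℕ} (hc : 0 < c) (h : x / c = y / c) :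
    |(x : ℝ) - y| ≤ c := by
  have hx := Nat.div_add_mod x c
  have hy := Nat.div_add_mod y c
  have hxm := Nat.mod_lt x hc
  have hym := Nat.mod_lt y hc
  rw [h] at hx
  rw [abs_le]
  constructor
  · have : y ≤ x + c := by omega
    have : (y : ℝ) ≤ x + c := by exact_mod_cast this
    linarith
  · have : x ≤ y + c := by omega
    have : (x : ℝ) ≤ y + c := by exact_mod_cast this
    linarith

variable {K : ℕ} {v : P → Fin N → ℝ} {R : P → ℕ} {H τ : ℝ}

/-- The increment of the chain between the representatives of a block of length `2 ^ k` and of the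
block of length `2 ^ (k + 1)` around it. -/
noncomputable def chainStep (v : P → Fin N → ℝ) (R : P → ℕ) (k b : ℕ) : Fin N → ℝ :=
  v (blockRep R k b) - v (blockRep R (k + 1) (b / 2))

/-- Both representatives have ranks in the same block of length `2 ^ (k + 1)`. -/
theorem sum_sq_chainStep_le
    (hd : ∀ p q, ∑ j, (v p j - v q j) ^ 2 ≤ 4 * H ^ 2 * |(R p : ℝ) - R q|) (k : ℕ) (q : P) :
    ∑ j, chainStep v R k (R q / 2 ^ k) j ^ 2 ≤ 4 * H ^ 2 * 2 ^ (k + 1) := by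
  have hb : R q / 2 ^ k / 2 = R q / 2 ^ (k + 1) := by rw [Nat.div_div_eq_div_mul, pow_succ]
  have h := abs_sub_le_of_div_eq (x := R (blockRep R k (R q / 2 ^ k)))
    (y := R (blockRep R (k + 1) (R q / 2 ^ k / 2))) (c := 2 ^ (k + 1)) (by positivity) (by
      rw [hb, blockRep_div, pow_succ, ← Nat.div_div_eq_div_mul, blockRep_div,
        Nat.div_div_eq_div_mul])
  refine (hd _ _).trans (mul_le_mul_of_nonneg_left ?_ (by positivity))
  exact_mod_cast h

/-- The chain telescopes. It ends in `v p` itself, since blocks of length `1` hold a single rank and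
equal ranks have distance zero. -/
theorem signedSum_eq_add_sum_chainStep
    (hd : ∀ p q, ∑ j, (v p j - v q j) ^ 2 ≤ 4 * H ^ 2 * |(R p : ℝ) - R q|) (m : ℕ)
    (σ : Fin N → Bool) (p : P) :
    signedSum σ (v p) = signedSum σ (v (blockRep R m (R p / 2 ^ m)))
      + ∑ k ∈ Finset.range m, signedSum σ (chainStep v R k (R p / 2 ^ k)) := by
  have h0 : v (blockRep R 0 (R p / 2 ^ 0)) = v p := by
    have hR := blockRep_div R 0 p
    rw [pow_zero, Nat.div_one, Nat.div_one] at hR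
    have h := hd (blockRep R 0 (R p)) p
    rw [hR, sub_self, abs_zero, mul_zero] at h
    have h' := (Finset.sum_eq_zero_iff_of_nonneg fun j _ => sq_nonneg _).mp
      (le_antisymm h (Finset.sum_nonneg fun j _ => sq_nonneg _))
    funext j
    rw [pow_zero, Nat.div_one]
    exact sub_eq_zero.mp (pow_eq_zero_iff two_ne_zero |>.mp (h' j (Finset.mem_univ _)))
  have hk : ∀ k ∈ Finset.range m, signedSum σ (chainStep v R k (R p / 2 ^ k))
      = signedSum σ (v (blockRep R k (R p / 2 ^ k)))
        - signedSum σ (v (blockRep R (k + 1) (R p / 2 ^ (k + 1)))) := fun k _ => by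
    rw [chainStep, signedSum_sub, Nat.div_div_eq_div_mul, ← pow_succ]
  rw [Finset.sum_congr rfl hk,
    Finset.sum_range_sub' fun k => signedSum σ (v (blockRep R k (R p / 2 ^ k))), h0]
  ring

/-- With `i = m - k`, the squared threshold shrinks like `(9 / 16) ^ i` and the variance like `2 ^
(-i)`, so the Hoeffding exponent is at least `A * (9 / 8) ^ i`, which is `≥ A + 2 * i` by Bernoulli
and `A ≥ 16`. The resulting `(1 / 4) ^ i` outweighs the number of blocks, which grows like `2 ^ i`.
-/
theorem card_lt_abs_signedSum_chainStep_le (hH : 0 < H) (hτ : 0 < τ) (hN : 0 < N)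
    (hA : 16 ≤ N * τ ^ 2 / (512 * H ^ 2))
    (hd : ∀ p q, ∑ j, (v p j - v q j) ^ 2 ≤ 4 * H ^ 2 * |(R p : ℝ) - R q|) {m k : ℕ} (hk : k ≤ m)
    (hm : (2 : ℝ) ^ m ≤ 2 * N) (q : P) :
    ((Finset.univ.filter fun σ : Fin N → Bool => N * τ / 4 * (3 / 4) ^ (m - k)
        < |signedSum σ (chainStep v R k (R q / 2 ^ k))|).card : ℝ)
      ≤ 2 ^ N * (2 * (Real.exp (-(N * τ ^ 2 / (512 * H ^ 2))) * (1 / 4) ^ (m - k))) := by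
  obtain ⟨i, rfl⟩ := Nat.exists_eq_add_of_le hk
  rw [Nat.add_sub_cancel_left]
  have hNr : (0 : ℝ) < N := by exact_mod_cast hN
  refine (card_lt_abs_signedSum_le _ (by positivity) (v := 4 * H ^ 2 * 2 ^ (k + 1))
    (by positivity) (sum_sq_chainStep_le hd k q)).trans ?_
  set A := N * τ ^ 2 / (512 * H ^ 2) with hAdef
  have hexp : A * (9 / 8 : ℝ) ^ i
      ≤ (N * τ / 4 * (3 / 4) ^ i) ^ 2 / (2 * (4 * H ^ 2 * 2 ^ (k + 1))) := by
    rw [le_div_iff₀ (by positivity)]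
    have e1 : A * (9 / 8 : ℝ) ^ i * (2 * (4 * H ^ 2 * 2 ^ (k + 1)))
        = N * τ ^ 2 / 32 * (9 / 16 : ℝ) ^ i * 2 ^ (k + i) := by
      rw [hAdef, show (9 / 8 : ℝ) = 9 / 16 * 2 by norm_num, mul_pow]
      field_simp
      ring
    have e2 : (N * τ / 4 * (3 / 4 : ℝ) ^ i) ^ 2
        = N * τ ^ 2 / 32 * (9 / 16 : ℝ) ^ i * (2 * N) := by
      rw [mul_pow, ← pow_mul, mul_comm i 2, pow_mul]
      norm_num
      ring
    rw [e1, e2]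
    gcongr
  have hbern : A + 2 * i ≤ A * (9 / 8 : ℝ) ^ i := by
    have h := one_add_mul_le_pow (show (-2 : ℝ) ≤ 1 / 8 by norm_num) i
    norm_num at h
    have hi : (0 : ℝ) ≤ i := Nat.cast_nonneg _
    nlinarith
  have he : Real.exp (-2) ≤ 1 / 4 := by
    rw [Real.exp_neg, show (1 / 4 : ℝ) = 4⁻¹ by norm_num]
    refine inv_anti₀ (by norm_num) ?_
    have := Real.add_one_le_exp (1 : ℝ)
    rw [show (2 : ℝ) = 1 + 1 by norm_num, Real.exp_add]
    nlinarith
  have hfin : Real.exp (-((N * τ / 4 * (3 / 4) ^ i) ^ 2 / (2 * (4 * H ^ 2 * 2 ^ (k + 1)))))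
      ≤ Real.exp (-A) * (1 / 4) ^ i := by
    calc _ ≤ Real.exp (-A + i * (-2)) := Real.exp_le_exp.mpr (by linarith)
      _ = Real.exp (-A) * Real.exp (-2) ^ i := by rw [Real.exp_add, Real.exp_nat_mul]
      _ ≤ _ := by gcongr
  gcongr

open Classical in
/-- **Chaining** along one parameter: a tail bound for the supremum of the signed sums of vectors
that are indexed by a rank in `{0, …, K * N}`, and whose squared distance is bounded by the
difference of the ranks. -/
theorem card_exists_lt_abs_signedSum_le (hH : 0 < H) (hτ : 0 < τ) (hN : 0 < N) (hK : 0 < K)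
    (hA : 16 ≤ N * τ ^ 2 / (512 * H ^ 2)) (hR : ∀ p, R p ≤ K * N) (hv : ∀ p j, |v p j| ≤ H)
    (hd : ∀ p q, ∑ j, (v p j - v q j) ^ 2 ≤ 4 * H ^ 2 * |(R p : ℝ) - R q|) :
    ((Finset.univ.filter fun σ : Fin N → Bool => ∃ p, N * τ < |signedSum σ (v p)|).card : ℝ)
      ≤ 2 ^ N * (8 * K * Real.exp (-(N * τ ^ 2 / (512 * H ^ 2)))) := by
  set A := N * τ ^ 2 / (512 * H ^ 2) with hAdef
  have hNr : (0 : ℝ) < N := by exact_mod_cast hN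
  have hKr : (1 : ℝ) ≤ K := by exact_mod_cast hK
  obtain ⟨m, hNm, hmN⟩ : ∃ m, N ≤ 2 ^ m ∧ 2 ^ m ≤ 2 * N := by
    refine ⟨Nat.log 2 N + 1, (Nat.lt_pow_succ_log_self one_lt_two N).le, ?_⟩
    have := Nat.pow_log_le_self 2 hN.ne'
    rw [pow_succ]
    omega
  set top : ℕ → Finset (Fin N → Bool) := fun b =>
    Finset.univ.filter fun σ => N * τ / 4 < |signedSum σ (v (blockRep R m b))|
  set lev : ℕ → ℕ → Finset (Fin N → Bool) := fun k b =>
    Finset.univ.filter fun σ => N * τ / 4 * (3 / 4) ^ (m - k) < |signedSum σ (chainStep v R k b)|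
  -- Only occupied blocks are kept: for the others `blockRep` is a junk value and the increment
  -- bound is not available.
  set blocks : ℕ → Finset ℕ := fun k =>
    (Finset.range (K * N / 2 ^ k + 1)).filter fun b => ∃ q, R q / 2 ^ k = b
  have hblocks : ∀ k p, R p / 2 ^ k ∈ blocks k := fun k p =>
    Finset.mem_filter.mpr ⟨Finset.mem_range.mpr (Nat.lt_succ_of_le (Nat.div_le_div_right (hR p))),
      p, rfl⟩
  have hsub : (Finset.univ.filter fun σ : Fin N → Bool => ∃ p, N * τ < |signedSum σ (v p)|)
      ⊆ (blocks m).biUnion top ∪ (Finset.range m).biUnion fun k => (blocks k).biUnion (lev k) := by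
    intro σ hσ
    obtain ⟨p, hp⟩ := (Finset.mem_filter.mp hσ).2
    by_contra hnot
    simp only [Finset.mem_union, Finset.mem_biUnion, not_or, not_exists, not_and] at hnot
    have h1 : |signedSum σ (v (blockRep R m (R p / 2 ^ m)))| ≤ N * τ / 4 := by
      by_contra! h
      exact hnot.1 _ (hblocks m p) (Finset.mem_filter.mpr ⟨Finset.mem_univ _, h⟩)
    have h2 : ∀ k ∈ Finset.range m, |signedSum σ (chainStep v R k (R p / 2 ^ k))|
        ≤ N * τ / 4 * (3 / 4) ^ (m - k) := by
      intro k hk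
      by_contra! h
      exact hnot.2 k hk _ (hblocks k p) (Finset.mem_filter.mpr ⟨Finset.mem_univ _, h⟩)
    have h3 := (Finset.abs_sum_le_sum_abs _ _).trans (Finset.sum_le_sum h2)
    rw [← Finset.mul_sum] at h3
    -- The top level has the budget `N * τ / 4` and the increments have `N * τ / 4 * 3`, in total `N
    -- * τ`.
    have h4 := sum_range_pow_sub_le (c := 3 / 4) (by norm_num) (by norm_num) m
    norm_num at h4
    have h5 : N * τ / 4 * ∑ k ∈ Finset.range m, (3 / 4 : ℝ) ^ (m - k) ≤ N * τ / 4 * 3 := by gcongr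
    rw [signedSum_eq_add_sum_chainStep hd m] at hp
    have h6 := abs_add_le (signedSum σ (v (blockRep R m (R p / 2 ^ m))))
      (∑ k ∈ Finset.range m, signedSum σ (chainStep v R k (R p / 2 ^ k)))
    linarith
  have hcardblocks : ∀ k ≤ m, ((blocks k).card : ℝ) ≤ 2 * K * 2 ^ (m - k) := by
    intro k hk
    have h1 : K * N / 2 ^ k ≤ K * 2 ^ (m - k) := by
      refine Nat.div_le_of_le_mul ?_
      calc K * N ≤ K * 2 ^ m := Nat.mul_le_mul_left _ hNm
        _ = 2 ^ k * (K * 2 ^ (m - k)) := by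
          rw [mul_left_comm, ← pow_add, Nat.add_sub_cancel' hk]
    have h2 : (blocks k).card ≤ K * 2 ^ (m - k) + 1 :=
      (Finset.card_filter_le _ _).trans (by rw [Finset.card_range]; omega)
    have h3 : 1 ≤ K * 2 ^ (m - k) := Nat.mul_pos hK (by positivity)
    have h4 : (blocks k).card ≤ 2 * K * 2 ^ (m - k) := by rw [mul_assoc]; omega
    exact_mod_cast h4
  have htop : ∀ b ∈ blocks m, ((top b).card : ℝ) ≤ 2 ^ N * (2 * Real.exp (-A)) := by
    intro b _
    have hsq : ∑ j, v (blockRep R m b) j ^ 2 ≤ N * H ^ 2 := by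
      have h := Finset.sum_le_card_nsmul Finset.univ (fun j => v (blockRep R m b) j ^ 2) (H ^ 2)
        fun j _ => sq_le_sq' (abs_le.mp (hv _ j)).1 (abs_le.mp (hv _ j)).2
      simpa using h
    refine (card_lt_abs_signedSum_le _ (by positivity) (by positivity) hsq).trans ?_
    have : A ≤ (N * τ / 4) ^ 2 / (2 * (N * H ^ 2)) := by
      rw [hAdef, div_le_div_iff₀ (by positivity) (by positivity)]
      have : 0 ≤ N ^ 2 * τ ^ 2 * H ^ 2 := by positivity
      nlinarith
    gcongr
  have hlev : ∀ k ∈ Finset.range m, ∀ b ∈ blocks k, ((lev k b).card : ℝ)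
      ≤ 2 ^ N * (2 * (Real.exp (-A) * (1 / 4) ^ (m - k))) := by
    intro k hk b hb
    obtain ⟨q, rfl⟩ := (Finset.mem_filter.mp hb).2
    exact card_lt_abs_signedSum_chainStep_le hH hτ hN hA hd (Finset.mem_range.mp hk).le
      (by exact_mod_cast hmN) q
  have hcardtop : (((blocks m).biUnion top).card : ℝ) ≤ 2 ^ N * (4 * K * Real.exp (-A)) := by
    calc (((blocks m).biUnion top).card : ℝ) ≤ ∑ b ∈ blocks m, ((top b).card : ℝ) := by
          exact_mod_cast Finset.card_biUnion_le
      _ ≤ (blocks m).card * (2 ^ N * (2 * Real.exp (-A))) := by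
          rw [← nsmul_eq_mul]
          exact Finset.sum_le_card_nsmul _ _ _ htop
      _ ≤ (2 * K * 2 ^ (m - m)) * (2 ^ N * (2 * Real.exp (-A))) := by
          gcongr
          exact hcardblocks m le_rfl
      _ = _ := by
          rw [Nat.sub_self]
          ring
  have hcardlev : ∀ k ∈ Finset.range m, (((blocks k).biUnion (lev k)).card : ℝ)
      ≤ 2 ^ N * (4 * K * Real.exp (-A)) * (1 / 2) ^ (m - k) := by
    intro k hk
    calc (((blocks k).biUnion (lev k)).card : ℝ) ≤ ∑ b ∈ blocks k, ((lev k b).card : ℝ) := by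
          exact_mod_cast Finset.card_biUnion_le
      _ ≤ (blocks k).card * (2 ^ N * (2 * (Real.exp (-A) * (1 / 4) ^ (m - k)))) := by
          rw [← nsmul_eq_mul]
          exact Finset.sum_le_card_nsmul _ _ _ (hlev k hk)
      _ ≤ (2 * K * 2 ^ (m - k)) * (2 ^ N * (2 * (Real.exp (-A) * (1 / 4) ^ (m - k)))) := by
          gcongr
          exact hcardblocks k (Finset.mem_range.mp hk).le
      _ = 2 ^ N * (4 * K * Real.exp (-A)) * (2 ^ (m - k) * (1 / 4) ^ (m - k)) := by ring
      _ = _ := by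
          rw [← mul_pow]
          norm_num
  have hsum := sum_range_pow_sub_le (c := 1 / 2) (by norm_num) (by norm_num) m
  norm_num at hsum
  have hall : (((Finset.range m).biUnion fun k => (blocks k).biUnion (lev k)).card : ℝ)
      ≤ 2 ^ N * (4 * K * Real.exp (-A)) := by
    calc _ ≤ ∑ k ∈ Finset.range m, (((blocks k).biUnion (lev k)).card : ℝ) := by
          exact_mod_cast Finset.card_biUnion_le
      _ ≤ ∑ k ∈ Finset.range m, 2 ^ N * (4 * K * Real.exp (-A)) * (1 / 2) ^ (m - k) :=
          Finset.sum_le_sum hcardlev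
      _ = 2 ^ N * (4 * K * Real.exp (-A)) * ∑ k ∈ Finset.range m, (1 / 2 : ℝ) ^ (m - k) := by
          rw [Finset.mul_sum]
      _ ≤ 2 ^ N * (4 * K * Real.exp (-A)) * 1 := by
          gcongr
      _ = _ := mul_one _
  calc _ ≤ (((blocks m).biUnion top).card : ℝ)
        + (((Finset.range m).biUnion fun k => (blocks k).biUnion (lev k)).card : ℝ) := by
        exact_mod_cast (Finset.card_le_card hsub).trans (Finset.card_union_le _ _)
    _ ≤ 2 ^ N * (4 * K * Real.exp (-A)) + 2 ^ N * (4 * K * Real.exp (-A)) :=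
        add_le_add hcardtop hall
    _ = _ := by ring

end Chaining

/-! ### Symmetrization and uniform deviations -/

section Symmetrization

theorem IsStepFunction.sub {K : ℕ} {f g : ℝ → ℝ} (hf : IsStepFunction K f)
    (hg : IsStepFunction K g) : IsStepFunction (2 * K) fun p => f p - g p := by
  have h := IsStepFunction.pi (ι := Bool) (g := fun b => cond b f g)
    fun b => by cases b <;> assumption
  refine h.of_eq fun p _ q _ hpq => ?_
  have h1 := congrFun hpq true
  have h2 := congrFun hpq false
  simp only [cond_true, cond_false] at h1 h2
  rw [h1, h2]

/-- A coordinate that changes contributes at most `(2 * H) ^ 2` and raises the total rank by at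
least one. -/
theorem sum_sq_sub_le_of_rank {N : ℕ} {H : ℝ} {s : Set ℝ} {v : ℝ → Fin N → ℝ} {r : Fin N → ℝ → ℕ}
    (hr : ∀ j, MonotoneOn (r j) s) (hv : ∀ p j, |v p j| ≤ H)
    (hrv : ∀ j, ∀ p ∈ s, ∀ q ∈ s, r j p = r j q → v p j = v q j) {p q : ℝ} (hp : p ∈ s)
    (hq : q ∈ s) :
    ∑ j, (v p j - v q j) ^ 2
      ≤ 4 * H ^ 2 * |((∑ j, r j p : ℕ) : ℝ) - ((∑ j, r j q : ℕ) : ℝ)| := by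
  wlog hpq : p ≤ q generalizing p q
  · rw [abs_sub_comm]
    simp only [fun j => sub_sq_comm (v p j) (v q j)]
    exact this hq hp (le_of_not_ge hpq)
  have hle : ((∑ j, r j p : ℕ) : ℝ) ≤ ((∑ j, r j q : ℕ) : ℝ) := by
    exact_mod_cast Finset.sum_le_sum fun j _ => hr j hp hq hpq
  rw [abs_sub_comm, abs_of_nonneg (sub_nonneg.mpr hle)]
  push_cast
  rw [← Finset.sum_sub_distrib, Finset.mul_sum]
  refine Finset.sum_le_sum fun j _ => ?_
  rcases (hr j hp hq hpq).eq_or_lt with h | h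
  · rw [hrv j p hp q hq h, h]
    simp
  · have h1 : (1 : ℝ) ≤ (r j q : ℝ) - r j p := by
      have : r j p + 1 ≤ r j q := h
      have : (r j p : ℝ) + 1 ≤ r j q := by exact_mod_cast this
      linarith
    have h2 := abs_le.mp (hv p j)
    have h3 := abs_le.mp (hv q j)
    have h4 : (v p j - v q j) ^ 2 ≤ (2 * H) ^ 2 := sq_le_sq' (by linarith) (by linarith)
    nlinarith [sq_nonneg H]

open Classical in
theorem card_exists_lt_abs_signedSum_le_of_isStepFunction {N K : ℕ} {H τ : ℝ} {v : ℝ → Fin N → ℝ}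
    (hH : 0 < H) (hτ : 0 < τ) (hN : 0 < N) (hK : 0 < K) (hA : 16 ≤ N * τ ^ 2 / (512 * H ^ 2))
    (hv : ∀ p j, |v p j| ≤ H) (hstep : ∀ j, IsStepFunction K fun p => v p j) :
    ((Finset.univ.filter fun σ : Fin N → Bool =>
        ∃ p ∈ Set.Icc (0 : ℝ) 1, N * τ < |signedSum σ (v p)|).card : ℝ)
      ≤ 2 ^ N * (8 * K * Real.exp (-(N * τ ^ 2 / (512 * H ^ 2)))) := by
  choose r hr hrK hrv using hstep
  have : Nonempty (Set.Icc (0 : ℝ) 1) := ⟨⟨0, by simp⟩⟩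
  have h := card_exists_lt_abs_signedSum_le (P := Set.Icc (0 : ℝ) 1) (v := fun p => v p.1)
    (R := fun p => ∑ j, r j p.1) (K := K) hH hτ hN hK hA (fun p => ?_) (fun p j => hv _ j)
    fun p q => sum_sq_sub_le_of_rank hr hv hrv p.2 q.2
  · simpa only [Subtype.exists, exists_prop] using h
  · have := Finset.sum_le_card_nsmul Finset.univ (fun j => r j p.1) K fun j _ => hrK j _ p.2
    simpa [mul_comm] using this

/-- Exchange the two components of `z j` for all `j` with `σ j = true`. -/
def swapAt {Ω : Type*} {N : ℕ} (σ : Fin N → Bool) (z : Fin N → Ω × Ω) : Fin N → Ω × Ω :=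
  fun j => (if σ j then Prod.swap else id) (z j)

theorem measurePreserving_swapAt {Ω : Type*} [MeasurableSpace Ω] {N : ℕ} (μ : Measure Ω) [IsProbabilityMeasure μ]
    (σ : Fin N → Bool) :
    MeasurePreserving (swapAt σ) (Measure.pi fun _ : Fin N => μ.prod μ)
      (Measure.pi fun _ : Fin N => μ.prod μ) := by
  refine measurePreserving_pi _ _ fun j => ?_
  split_ifs
  · exact Measure.measurePreserving_swap
  · exact MeasurePreserving.id _

theorem sum_swapAt_sub {Ω : Type*} {N : ℕ} (σ : Fin N → Bool) (z : Fin N → Ω × Ω) (f : Ω → ℝ) :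
    ∑ j, (f (swapAt σ z j).1 - f (swapAt σ z j).2)
      = signedSum σ fun j => f (z j).1 - f (z j).2 := by
  refine Finset.sum_congr rfl fun j _ => ?_
  cases h : σ j <;> simp [swapAt, boolSign, h]

/-- If the deviations at the minimizer and at a competitor are at most `N * ε / 2` each, their
expected losses differ by at most `ε` in the wrong direction. -/
theorem exists_lt_deviation_of_isERM {Ω : Type*} [MeasurableSpace Ω] {μ : Measure Ω}
    {L : ℝ → Ω → ℝ} {ε : ℝ} {N : ℕ} (hN : 0 < N) {S : Fin N → Ω} {p : ℝ}
    (hp : IsERM L S p) (h : ¬ IsEpsOptimal L μ ε p) :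
    ∃ q ∈ Set.Icc (0 : ℝ) 1, N * (ε / 2) < |∑ j, L q (S j) - N * ∫ ω, L q ω ∂μ| := by
  have hNr : (0 : ℝ) < N := by exact_mod_cast hN
  simp only [IsEpsOptimal, not_forall, not_le] at h
  obtain ⟨q, hq, hlt⟩ := h
  by_contra! hno
  have h1 := abs_le.mp (hno p hp.1)
  have h2 := abs_le.mp (hno q hq)
  have h3 := hp.2 q hq
  have h4 := mul_lt_mul_of_pos_left hlt hNr
  linarith

variable {Ω : Type*} [MeasurableSpace Ω] {μ : Measure Ω} [IsProbabilityMeasure μ] {L : ℝ → Ω → ℝ} {H ε : ℝ} {K N : ℕ}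

/-- All `2 ^ N` coordinate swaps preserve the product measure, so the probability is an average over
signs for fixed `z`, which chaining bounds. Differences of two losses have `2 * K` changes, hence
`16 * K`. -/
theorem measure_exists_lt_sum_sub_le {τ : ℝ} (hH : 0 < H) (hτ : 0 < τ) (hN : 0 < N) (hK : 0 < K)
    (hA : 16 ≤ N * τ ^ 2 / (512 * H ^ 2)) (hL : ∀ p ω, 0 ≤ L p ω ∧ L p ω ≤ H)
    (hstep : ∀ᵐ ω ∂μ, IsStepFunction K fun p => L p ω)
    (hmeas : MeasurableSet {z : Fin N → Ω × Ω | ∃ p ∈ Set.Icc (0 : ℝ) 1,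
      N * τ < |∑ j, (L p (z j).1 - L p (z j).2)|}) :
    Measure.pi (fun _ : Fin N => μ.prod μ) {z | ∃ p ∈ Set.Icc (0 : ℝ) 1,
        N * τ < |∑ j, (L p (z j).1 - L p (z j).2)|}
      ≤ ENNReal.ofReal (16 * K * Real.exp (-(N * τ ^ 2 / (512 * H ^ 2)))) := by
  classical
  set B := {z : Fin N → Ω × Ω | ∃ p ∈ Set.Icc (0 : ℝ) 1,
    N * τ < |∑ j, (L p (z j).1 - L p (z j).2)|}
  set ν := Measure.pi fun _ : Fin N => μ.prod μ
  set η := 16 * K * Real.exp (-(N * τ ^ 2 / (512 * H ^ 2)))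
  have hη : 0 ≤ η := by positivity
  have hae : ∀ᵐ z ∂ν, ∀ j, (IsStepFunction K fun p => L p (z j).1) ∧
      IsStepFunction K fun p => L p (z j).2 := by
    rw [ae_all_iff]
    intro j
    have h1 := (measurePreserving_fst (μ := μ) (ν := μ)).quasiMeasurePreserving.ae hstep
    have h2 := (measurePreserving_snd (μ := μ) (ν := μ)).quasiMeasurePreserving.ae hstep
    exact (measurePreserving_eval (fun _ : Fin N => μ.prod μ) j).quasiMeasurePreserving.ae
      (h1.and h2)
  have hcount : ∀ᵐ z ∂ν, ∑ σ : Fin N → Bool, (swapAt σ ⁻¹' B).indicator (fun _ => (1 : ENNReal)) z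
      ≤ 2 ^ N * ENNReal.ofReal η := by
    filter_upwards [hae] with z hz
    have hcard := card_exists_lt_abs_signedSum_le_of_isStepFunction
      (v := fun p j => L p (z j).1 - L p (z j).2) hH hτ hN (Nat.mul_pos two_pos hK) hA
      (fun p j => abs_le.mpr ⟨by linarith [hL p (z j).1, hL p (z j).2],
        by linarith [hL p (z j).1, hL p (z j).2]⟩) fun j => (hz j).1.sub (hz j).2
    have hsum : ∑ σ : Fin N → Bool, (swapAt σ ⁻¹' B).indicator (fun _ => (1 : ENNReal)) z
        = ((Finset.univ.filter fun σ : Fin N → Bool => ∃ p ∈ Set.Icc (0 : ℝ) 1,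
          N * τ < |signedSum σ fun j => L p (z j).1 - L p (z j).2|).card : ENNReal) := by
      rw [Finset.card_filter, Nat.cast_sum]
      refine Finset.sum_congr rfl fun σ _ => ?_
      have hmem : z ∈ swapAt σ ⁻¹' B ↔ ∃ p ∈ Set.Icc (0 : ℝ) 1,
          N * τ < |signedSum σ fun j => L p (z j).1 - L p (z j).2| := by
        simp only [B, Set.mem_preimage, Set.mem_ofPred_eq, fun p => sum_swapAt_sub σ z (L p)]
      rw [Set.indicator_apply, hmem]
      split_ifs <;> simp
    rw [hsum, ← ENNReal.ofReal_natCast]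
    refine (ENNReal.ofReal_le_ofReal hcard).trans (le_of_eq ?_)
    rw [ENNReal.ofReal_mul (by positivity), ENNReal.ofReal_pow (by norm_num)]
    congr 1
    · simp
    · congr 1
      simp only [η]
      push_cast
      ring
  have hint : (2 ^ N : ENNReal) * ν B ≤ 2 ^ N * ENNReal.ofReal η := by
    calc (2 ^ N : ENNReal) * ν B = ∑ σ : Fin N → Bool, ν (swapAt σ ⁻¹' B) := by
          rw [Finset.sum_congr rfl fun σ _ =>
            (measurePreserving_swapAt μ σ).measure_preimage hmeas.nullMeasurableSet]
          simp
          rfl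
      _ = ∑ σ : Fin N → Bool, ∫⁻ z, (swapAt σ ⁻¹' B).indicator (fun _ => (1 : ENNReal)) z ∂ν :=
          Finset.sum_congr rfl fun σ _ => (lintegral_indicator_one
            ((measurePreserving_swapAt μ σ).measurable hmeas)).symm
      _ = ∫⁻ z, ∑ σ : Fin N → Bool, (swapAt σ ⁻¹' B).indicator (fun _ => (1 : ENNReal)) z ∂ν :=
          (lintegral_finsetSum _ fun σ _ => measurable_const.indicator
            ((measurePreserving_swapAt μ σ).measurable hmeas)).symm
      _ ≤ ∫⁻ _, 2 ^ N * ENNReal.ofReal η ∂ν := lintegral_mono_ae hcount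
      _ = _ := by simp
  exact (ENNReal.mul_le_mul_iff_right (by positivity) (by finiteness)).mp hint

/-- Chebyshev: the variance is at most `N * (H / 2) ^ 2`, so the probability is at most `4 * H ^ 2 /
(N * ε ^ 2)`. -/
theorem measure_le_abs_sum_sub_le (hε : 0 < ε) (hN : 0 < N) {f : Ω → ℝ} (hf : Measurable f)
    (hf0 : ∀ ω, 0 ≤ f ω ∧ f ω ≤ H) (hNε : 8 * H ^ 2 ≤ N * ε ^ 2) :
    Measure.pi (fun _ : Fin N => μ) {S | N * (ε / 4) ≤ |∑ j, f (S j) - N * ∫ ω, f ω ∂μ|}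
      ≤ 1 / 2 := by
  have hNr : (0 : ℝ) < N := by exact_mod_cast hN
  have hbd : ∀ᵐ ω ∂μ, f ω ∈ Set.Icc 0 H := ae_of_all _ hf0
  have hLp : MemLp f 2 μ := memLp_of_bounded hbd hf.aestronglyMeasurable 2
  have hvar : ProbabilityTheory.variance (∑ j : Fin N, fun S : Fin N → Ω => f (S j))
      (Measure.pi fun _ : Fin N => μ) ≤ N * (H / 2) ^ 2 := by
    rw [ProbabilityTheory.variance_sum_pi fun _ => hLp]
    have := ProbabilityTheory.variance_le_sq_of_bounded hbd hf.aemeasurable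
    rw [Finset.sum_const, Finset.card_univ, Fintype.card_fin, nsmul_eq_mul]
    rw [sub_zero] at this
    gcongr
  have hev := fun j : Fin N => measurePreserving_eval (fun _ : Fin N => μ) j
  have hLpS : MemLp (∑ j : Fin N, fun S : Fin N → Ω => f (S j)) 2
      (Measure.pi fun _ : Fin N => μ) :=
    memLp_finsetSum' _ fun j _ => hLp.comp_measurePreserving (hev j)
  have hmean : ∫ S, (∑ j : Fin N, fun S : Fin N → Ω => f (S j)) S ∂(Measure.pi fun _ : Fin N => μ)
      = N * ∫ ω, f ω ∂μ := by
    simp only [Finset.sum_apply]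
    have hint : ∀ j : Fin N, Integrable (fun S : Fin N → Ω => f (S j))
        (Measure.pi fun _ : Fin N => μ) := fun j =>
      (hLp.comp_measurePreserving (hev j)).integrable one_le_two
    rw [integral_finsetSum _ fun j _ => hint j]
    have : ∀ j : Fin N, ∫ S : Fin N → Ω, f (S j) ∂(Measure.pi fun _ : Fin N => μ)
        = ∫ ω, f ω ∂μ := fun j =>
      integral_comp_eval (μ := fun _ : Fin N => μ) hf.aestronglyMeasurable
    simp [this]
  have h := ProbabilityTheory.meas_ge_le_variance_div_sq hLpS
    (show 0 < N * (ε / 4) by positivity)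
  rw [hmean] at h
  simp only [Finset.sum_apply] at h
  refine h.trans ?_
  rw [show (1 / 2 : ENNReal) = ENNReal.ofReal (1 / 2) by
    rw [ENNReal.ofReal_div_of_pos two_pos]
    simp]
  refine ENNReal.ofReal_le_ofReal ?_
  rw [div_le_iff₀ (by positivity)]
  refine hvar.trans ?_
  nlinarith

/-- **Uniform deviation bound** for a bounded one-parameter family of step functions. -/
theorem measure_exists_lt_deviation_le (hH : 0 < H) (hε : 0 < ε) (hN : 0 < N) (hK : 0 < K)
    (hA : 16 ≤ N * ε ^ 2 / (8192 * H ^ 2)) (hL : ∀ p ω, 0 ≤ L p ω ∧ L p ω ≤ H)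
    (hLm : ∀ p, Measurable (L p)) (hstep : ∀ᵐ ω ∂μ, IsStepFunction K fun p => L p ω)
    (hmeas : ∀ c, MeasurableSet {z : Fin N → Ω × Ω | ∃ p ∈ Set.Icc (0 : ℝ) 1,
      c < |∑ j, (L p (z j).1 - L p (z j).2)|}) :
    Measure.pi (fun _ : Fin N => μ) {S | ∃ p ∈ Set.Icc (0 : ℝ) 1,
        N * (ε / 2) < |∑ j, L p (S j) - N * ∫ ω, L p ω ∂μ|}
      ≤ ENNReal.ofReal (32 * K * Real.exp (-(N * ε ^ 2 / (8192 * H ^ 2)))) := by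
  have hNr : (0 : ℝ) < N := by exact_mod_cast hN
  have hAeq : N * (ε / 4) ^ 2 / (512 * H ^ 2) = N * ε ^ 2 / (8192 * H ^ 2) := by
    field_simp
    ring
  have hsym := measure_exists_lt_sum_sub_le hH (show 0 < ε / 4 by positivity) hN hK
    (by rwa [hAeq]) hL hstep (hmeas _)
  rw [hAeq] at hsym
  set μN := Measure.pi fun _ : Fin N => μ
  set B2 := {z : (Fin N → Ω) × (Fin N → Ω) | ∃ p ∈ Set.Icc (0 : ℝ) 1,
    N * (ε / 4) < |∑ j, (L p (z.1 j) - L p (z.2 j))|}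
  have hpre : {z : Fin N → Ω × Ω | ∃ p ∈ Set.Icc (0 : ℝ) 1,
      N * (ε / 4) < |∑ j, (L p (z j).1 - L p (z j).2)|}
      = MeasurableEquiv.arrowProdEquivProdArrow Ω Ω (Fin N) ⁻¹' B2 := rfl
  have hB2 : MeasurableSet B2 := by
    have := hmeas (N * (ε / 4))
    rwa [hpre, MeasurableEquiv.measurableSet_preimage] at this
  rw [hpre, (measurePreserving_arrowProdEquivProdArrow Ω Ω (Fin N) (fun _ => μ)
    (fun _ => μ)).measure_preimage hB2.nullMeasurableSet, Measure.prod_apply hB2] at hsym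
  have hNε : 8 * H ^ 2 ≤ N * ε ^ 2 := by
    rw [le_div_iff₀ (by positivity)] at hA
    nlinarith [sq_nonneg H]
  -- If `S` deviates by `ε / 2` at `p`, at least half of the ghost samples deviate by less than `ε /
  -- 4` there, and the pair differs by more than `ε / 4`. Measurability of the left-hand set is not
  -- needed; Markov's inequality with threshold `1 / 2` then costs a factor `2`.
  have hsub : {S : Fin N → Ω | ∃ p ∈ Set.Icc (0 : ℝ) 1,
      N * (ε / 2) < |∑ j, L p (S j) - N * ∫ ω, L p ω ∂μ|}
      ⊆ {S | 1 / 2 ≤ μN (Prod.mk S ⁻¹' B2)} := by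
    rintro S ⟨p, hp, hS⟩
    have hcheb := measure_le_abs_sum_sub_le (μ := μ) hε hN (hLm p) (hL p) hNε
    have hms : MeasurableSet {S : Fin N → Ω |
        N * (ε / 4) ≤ |∑ j, L p (S j) - N * ∫ ω, L p ω ∂μ|} := by
      refine measurableSet_le measurable_const ?_
      have : Measurable fun S : Fin N → Ω => ∑ j, L p (S j) - N * ∫ ω, L p ω ∂μ :=
        (Finset.measurable_fun_sum _ fun j _ =>
          (hLm p).comp (measurable_pi_apply j)).sub measurable_const
      exact this.abs
    have hcompl : {S : Fin N → Ω | N * (ε / 4) ≤ |∑ j, L p (S j) - N * ∫ ω, L p ω ∂μ|}ᶜ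
        ⊆ Prod.mk S ⁻¹' B2 := by
      intro S' hS'
      have hS' : |∑ j, L p (S' j) - N * ∫ ω, L p ω ∂μ| < N * (ε / 4) := not_le.mp hS'
      refine ⟨p, hp, ?_⟩
      rw [Finset.sum_sub_distrib]
      have := abs_sub_le (∑ j, L p (S j)) (∑ j, L p (S' j)) (N * ∫ ω, L p ω ∂μ)
      dsimp only
      linarith
    refine le_trans ?_ (measure_mono hcompl)
    rw [prob_compl_eq_one_sub hms]
    refine ENNReal.le_sub_of_add_le_left (by finiteness) ?_
    calc _ ≤ (1 / 2 : ENNReal) + 1 / 2 := by gcongr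
      _ = 1 := ENNReal.add_halves 1
  have hmarkov := mul_meas_ge_le_lintegral₀ (μ := μN) (f := fun S => μN (Prod.mk S ⁻¹' B2))
    (measurable_measure_prodMk_left hB2).aemeasurable (1 / 2)
  calc μN _ ≤ μN {S | 1 / 2 ≤ μN (Prod.mk S ⁻¹' B2)} := measure_mono hsub
    _ = 2 * (1 / 2 * μN {S | 1 / 2 ≤ μN (Prod.mk S ⁻¹' B2)}) := by
        rw [← mul_assoc, one_div, ENNReal.mul_inv_cancel two_ne_zero (by finiteness), one_mul]
    _ ≤ 2 * ENNReal.ofReal (16 * K * Real.exp (-(N * ε ^ 2 / (8192 * H ^ 2)))) := by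
        gcongr
        exact hmarkov.trans hsym
    _ = _ := by
        rw [show (2 : ENNReal) = ENNReal.ofReal 2 by simp, ← ENNReal.ofReal_mul (by norm_num)]
        congr 1
        ring

end Symmetrization

/-! ### Application to the Tweedie loss -/

section TweedieLoss

variable {X : Type*} {n t : ℕ} {F : Finset (X → Bool)}
  {tie : RegTree X → Finset (List Bool × (X → Bool)) → List Bool × (X → Bool)} {ℓ : ℝ → ℝ → ℝ}
  {H : ℝ}

theorem RegTree.loss_mem_Icc (hH : 0 < H) (hℓ : ∀ u y, 0 ≤ ℓ u y ∧ ℓ u y ≤ H) (T : RegTree X)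
    (D : RegDataset X n) : 0 ≤ T.loss ℓ D ∧ T.loss ℓ D ≤ H := by
  refine ⟨mul_nonneg (by positivity) (Finset.sum_nonneg fun i _ => (hℓ _ _).1), ?_⟩
  rcases Nat.eq_zero_or_pos n with rfl | hn
  · simpa [loss] using hH.le
  · have hn' : (0 : ℝ) < n := by exact_mod_cast hn
    have h := Finset.sum_le_card_nsmul Finset.univ
      (fun i => ℓ (T.predict D (D i).1) (D i).2) H fun i _ => (hℓ _ _).2
    rw [Finset.card_univ, Fintype.card_fin, nsmul_eq_mul] at h
    rw [loss, one_div, inv_mul_le_iff₀ hn']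
    exact h

/-- These cases are separated because `n ≤ t * (log |F| + n)` can fail for `t = 0`, and the final
count uses `n ≥ 1`. -/
theorem tweedieLoss_eq_of_degenerate (h : n = 0 ∨ t = 0) (p q : ℝ) (D : RegDataset X n) :
    tweedieLoss F tie t ℓ p D = tweedieLoss F tie t ℓ q D := by
  rcases h with rfl | rfl
  · simp [tweedieLoss, RegTree.loss]
  · rfl

theorem isStepFunction_tweedieLoss (D : RegDataset X n) (hD : ∀ i, 0 ≤ (D i).2) :
    IsStepFunction (16 ^ n * 14) fun p => tweedieLoss F tie t ℓ p D :=
  (RegTree.isStepFunction_topDown F tie D hD t).of_eq fun p _ q _ hpq => by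
    simp only [tweedieLoss, hpq]

theorem exists_isERM_tweedieLoss (hne : F.Nonempty) (htie : ∀ T s, s.Nonempty → tie T s ∈ s) (N : ℕ)
    (S : Fin N → RegDataset X n) : ∃ p, IsERM (tweedieLoss F tie t ℓ) S p := by
  classical
  obtain ⟨s, hs⟩ := RegTree.exists_finset_topDown hne htie n t
  have hfin : ((fun p => ∑ j, tweedieLoss F tie t ℓ p (S j)) '' Set.Icc 0 1).Finite := by
    refine ((Fintype.piFinset fun _ : Fin N => s).image
      fun T => ∑ j, (T j).loss ℓ (S j)).finite_toSet.subset ?_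
    rintro _ ⟨p, -, rfl⟩
    exact Finset.mem_coe.mpr (Finset.mem_image.mpr
      ⟨fun j => RegTree.topDown F tie p (S j) t, Fintype.mem_piFinset.mpr fun j => hs p (S j), rfl⟩)
  obtain ⟨_, ⟨p, hp, rfl⟩, hmin⟩ := hfin.exists_minimal ⟨_, 0, by simp, rfl⟩
  refine ⟨p, hp, fun q hq => ?_⟩
  by_contra! hlt
  exact absurd (hmin ⟨q, hq, rfl⟩ hlt.le) (not_le.mpr hlt)

variable [MeasurableSpace X]

theorem measure_not_isEpsOptimal_le (hne : F.Nonempty) (hF : ∀ f ∈ F, Measurable f)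
    (htie : ∀ T s, s.Nonempty → tie T s ∈ s) (hH : 0 < H) (hℓm : Measurable (Function.uncurry ℓ))
    (hℓ : ∀ u y, 0 ≤ ℓ u y ∧ ℓ u y ≤ H) (𝒟 : Measure (RegDataset X n)) [IsProbabilityMeasure 𝒟]
    (h𝒟 : ∀ᵐ D ∂𝒟, ∀ i, 0 ≤ (D i).2) {ε δ : ℝ} (hε : 0 < ε) (hδ : 0 < δ) {N : ℕ}
    (hN : 131072 * (H / ε) ^ 2 * ((t : ℝ) * (Real.log (F.card : ℝ) + (n : ℝ)) + Real.log (1 / δ))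
      ≤ (N : ℝ)) :
    Measure.pi (fun _ : Fin N => 𝒟) {S | ¬ ∀ p, IsERM (tweedieLoss F tie t ℓ) S p →
      IsEpsOptimal (tweedieLoss F tie t ℓ) 𝒟 ε p} ≤ ENNReal.ofReal δ := by
  by_cases hdeg : n = 0 ∨ t = 0
  · convert zero_le (a := ENNReal.ofReal δ)
    refine measure_mono_null (t := ∅) (fun S hS => hS fun p _ q _ => ?_) measure_empty
    rw [funext (tweedieLoss_eq_of_degenerate hdeg p q)]
    linarith
  rw [not_or] at hdeg
  rcases le_or_gt 1 δ with hδ1 | hδ1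
  · exact prob_le_one.trans (by simpa using ENNReal.ofReal_le_ofReal hδ1)
  have hn : (1 : ℝ) ≤ n := by exact_mod_cast Nat.one_le_iff_ne_zero.mpr hdeg.1
  have ht : (1 : ℝ) ≤ t := by exact_mod_cast Nat.one_le_iff_ne_zero.mpr hdeg.2
  have hlogF : 0 ≤ Real.log (F.card : ℝ) := Real.log_natCast_nonneg _
  have hlogδ : 0 ≤ Real.log (1 / δ) := Real.log_nonneg (by rw [le_div_iff₀ hδ]; linarith)
  set A := N * ε ^ 2 / (8192 * H ^ 2) with hAdef
  -- The constant is `131072 = 16 * 8192`.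
  have hA : 16 * (n + Real.log (1 / δ)) ≤ A := by
    rw [hAdef, le_div_iff₀ (by positivity)]
    have h1 : (n : ℝ) ≤ t * (Real.log (F.card : ℝ) + n) := by nlinarith
    have h2 : 131072 * (H / ε) ^ 2 * (n + Real.log (1 / δ)) ≤ N := by
      refine le_trans ?_ hN
      gcongr
    calc 16 * (n + Real.log (1 / δ)) * (8192 * H ^ 2)
        = 131072 * (H / ε) ^ 2 * (n + Real.log (1 / δ)) * ε ^ 2 := by
          field_simp
          ring
      _ ≤ N * ε ^ 2 := by gcongr
  have hA16 : 16 ≤ A := by linarith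
  have hNpos : 0 < N := by
    rcases Nat.eq_zero_or_pos N with rfl | h
    · norm_num [hAdef] at hA16
    · exact h
  have hL : ∀ (p : ℝ) (D : RegDataset X n),
      0 ≤ tweedieLoss F tie t ℓ p D ∧ tweedieLoss F tie t ℓ p D ≤ H :=
    fun p D => RegTree.loss_mem_Icc hH hℓ _ D
  have hdev := measure_exists_lt_deviation_le (μ := 𝒟) (L := tweedieLoss F tie t ℓ) hH hε hNpos
    (K := 16 ^ n * 14) (by positivity) hA16 hL
    (fun p => measurable_tweedieLoss hne hF htie hℓm t p)
    (h𝒟.mono fun D hD => isStepFunction_tweedieLoss D hD)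
    fun c => measurableSet_exists_lt_sum_tweedieLoss hne hF htie hℓm t N c
  refine (measure_mono fun S hS => ?_).trans (hdev.trans (ENNReal.ofReal_le_ofReal ?_))
  · obtain ⟨p, hp⟩ := not_forall.mp hS
    obtain ⟨hERM, hopt⟩ := Classical.not_imp.mp hp
    exact exists_lt_deviation_of_isERM hNpos hERM hopt
  · have he : (2 : ℝ) ^ 16 ≤ Real.exp 16 := by
      have := Real.add_one_le_exp (1 : ℝ)
      rw [show (16 : ℝ) = (16 : ℕ) * 1 by norm_num, Real.exp_nat_mul]
      gcongr
      linarith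
    -- The prefactor is absorbed by the part `16 * n` of `A`: `32 * 14 = 448`, and `448 * 16 = 7168
    -- ≤ 2 ^ 16 ≤ exp 16`.
    have hcount : (32 * (16 ^ n * 14 : ℕ) : ℝ) ≤ Real.exp (16 * n) := by
      rw [mul_comm (16 : ℝ), Real.exp_nat_mul]
      calc (32 * (16 ^ n * 14 : ℕ) : ℝ) = 16 ^ n * 448 ^ 1 := by
            push_cast
            ring
        _ ≤ 16 ^ n * 448 ^ n := by
            gcongr
            · norm_num
            · exact Nat.one_le_iff_ne_zero.mpr hdeg.1
        _ = 7168 ^ n := by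
            rw [← mul_pow]
            norm_num
        _ ≤ Real.exp 16 ^ n := by
            gcongr
            linarith
    calc 32 * ((16 ^ n * 14 : ℕ) : ℝ) * Real.exp (-A)
        ≤ Real.exp (16 * n) * Real.exp (-A) := by gcongr
      _ = Real.exp (16 * n - A) := by rw [← Real.exp_add, sub_eq_add_neg]
      _ ≤ Real.exp (Real.log δ) := by
          refine Real.exp_le_exp.mpr ?_
          rw [one_div, Real.log_inv] at hA hlogδ
          linarith
      _ = δ := Real.exp_log hδ

end TweedieLoss

theorem mainTheorem4 :
    ∃ C : ℝ, 0 < C ∧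
      -- sample complexity of tuning the Tweedie power by empirical risk minimization
      (∀ (X : Type*) [MeasurableSpace X] (n t : ℕ)
        (F : Finset (X → Bool)) (_ : F.Nonempty) (_ : ∀ f ∈ F, Measurable f)
        (tie : RegTree X → Finset (List Bool × (X → Bool)) → List Bool × (X → Bool))
        (_ : ∀ T s, s.Nonempty → tie T s ∈ s)
        (H : ℝ) (_ : 0 < H) (ℓ : ℝ → ℝ → ℝ) (_ : Measurable (Function.uncurry ℓ))
        (_ : ∀ u y, 0 ≤ ℓ u y ∧ ℓ u y ≤ H)
        (𝒟 : Measure (RegDataset X n)) [IsProbabilityMeasure 𝒟]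
        (_ : ∀ᵐ D ∂𝒟, ∀ i, 0 ≤ (D i).2),
        (∀ p ∈ Set.Icc (0 : ℝ) 1, Integrable (tweedieLoss F tie t ℓ p) 𝒟) ∧
        (∀ (N : ℕ) (S : Fin N → RegDataset X n), ∃ p, IsERM (tweedieLoss F tie t ℓ) S p) ∧
        ∀ (ε δ : ℝ), 0 < ε → 0 < δ → ∀ N : ℕ,
          C * (H / ε) ^ 2 * ((t : ℝ) * (Real.log (F.card : ℝ) + (n : ℝ)) + Real.log (1 / δ))
            ≤ (N : ℝ) →
          Measure.pi (fun _ : Fin N => 𝒟)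
            {S | ¬ ∀ p, IsERM (tweedieLoss F tie t ℓ) S p →
              IsEpsOptimal (tweedieLoss F tie t ℓ) 𝒟 ε p} ≤ ENNReal.ofReal δ) ∧
      -- each comparison of two splits is an equation in `p` with `O(n)` terms and `O(n)` roots
      (∀ (X : Type*) (n : ℕ) (D : RegDataset X n) (_ : ∀ i, 0 ≤ (D i).2)
        (T : RegTree X) (a₁ a₂ : List Bool) (_ : a₁ ∈ T.leaves) (_ : a₂ ∈ T.leaves)
        (f₁ f₂ : X → Bool),
        (∃ (m : ℕ) (c b : Fin m → ℝ), (m : ℝ) ≤ C * (n : ℝ) ∧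
          ∀ p ∈ Set.Ico (0 : ℝ) 1,
            (1 - p) * (2 - p) * ((T.split a₁ f₁).splitObjective p D
                - (T.split a₂ f₂).splitObjective p D)
              = ∑ j, c j * Real.exp (b j * p)) ∧
        ((∀ p ∈ Set.Icc (0 : ℝ) 1,
            (T.split a₁ f₁).splitObjective p D = (T.split a₂ f₂).splitObjective p D) ∨
          ({p ∈ Set.Icc (0 : ℝ) 1 |
              (T.split a₁ f₁).splitObjective p D = (T.split a₂ f₂).splitObjective p D}.Finite ∧
            (Set.ncard {p ∈ Set.Icc (0 : ℝ) 1 |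
              (T.split a₁ f₁).splitObjective p D = (T.split a₂ f₂).splitObjective p D} : ℝ)
              ≤ C * (n : ℝ)))) := by
  -- The sample bound dictates the constant; the split comparisons only need `7`.
  refine ⟨131072, by norm_num, ?_, ?_⟩
  · intro X _ n t F hne hF tie htie H hH ℓ hℓm hℓ 𝒟 _ h𝒟
    refine ⟨fun p _ => ?_, fun N S => exists_isERM_tweedieLoss hne htie N S,
      fun ε δ hε hδ N hN => measure_not_isEpsOptimal_le hne hF htie hH hℓm hℓ 𝒟 h𝒟 hε hδ hN⟩
    exact Integrable.of_mem_Icc 0 H (measurable_tweedieLoss hne hF htie hℓm t p).aemeasurable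
      (ae_of_all _ fun D => RegTree.loss_mem_Icc hH hℓ _ D)
  · intro X n D hD T a₁ a₂ h₁ h₂ f₁ f₂
    exact ⟨exists_expSum_split_sub (by norm_num) D hD T h₁ h₂ f₁ f₂,
      split_eq_or_finite (by norm_num) D hD T h₁ h₂ f₁ f₂⟩
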